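/- Let $S_\infty$ be the group of permutations of $\mathbb{P}=\{1,2,\dots\}$ fixing all but finitely many elements, let $s_i=(i,i+1)$, and let $\ell(w)$ be the least number of factors in an expression of $w$ as a product of $s_i$'s; the expressions $(a_1,\dots,a_p)$ attaining it are the reduced words of $w$. Write $u\to v$ if $v=u(a,b)$ with $a<b$ and $\ell(v)=\ell(u)+1$; put $\mu(u\to v)=x_a-x_b$, and write $u\xrightarrow{k}v$ if moreover $a\le k<b$. Bruhat order $\le$ is the reflexive transitive closure of $\to$. For $u\le w$ and $p=\ell(w)-\ell(u)$, the skew dual Schubert polynomial is $$\mathfrak D_{u,w}=\frac1{p!}\sum_{u=v_0\to v_1\to\dots\to v_p=w}\ \prod_{i=1}^p\mu(v_{i-1}\to v_i)\in\mathbb C[x_1,x_2,\dots].$$ Let $$\mathfrak S_w=\sum_{(a_1,\dots,a_p)}\ \sum_{i_1\le\dots\le i_p}x_{i_1}\cdots x_{i_p}$$ be the Schubert polynomials; the outer sum is over reduced words of $w$, the inner one over sequences with $i_j\le a_j$ for all $j$ and $i_j=i_{j+1}$ only if $a_j>a_{j+1}$. They form a basis of $\mathbb C[x_1,x_2,\dots]$.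 Let $c^w_{uv}$ be the coefficients in $\mathfrak S_u\mathfrak S_v=\sum_w c^w_{uv}\mathfrak S_w$, and let $\mathfrak D_w$ be the dual Schubert polynomials, determined by $\langle\mathfrak S_u,\mathfrak D_w\rangle=\delta_{uw}$ for all $u$, where $\langle f,g\rangle=f(\partial/\partial x_1,\partial/\partial x_2,\dots)\,g\,|_{x=0}$. Let $X_i=x_i-x_{i+1}$, and for $\alpha=(\alpha_1,\alpha_2,\dots)$ with finitely many nonzero entries let $X^\alpha=\prod_i X_i^{\alpha_i}$, $\alpha!=\prod_i\alpha_i!$ and $|\alpha|=\sum_i\alpha_i$. On $\mathbb C[X_1,X_2,\dots]$ let $\overline{\,\cdot\,}$ be the linear map with $\overline{X^\alpha}=\frac{|\alpha|!}{\alpha!}X^\alpha$, and let $\widetilde{\,\cdot\,}$ be its inverse, $\widetilde{X^\alpha}=\frac{\alpha!}{|\alpha|!}X^\alpha$. Fix a total order $\prec$ on $\mathbb P$. For $u\le w$ let $\mathcal C_\prec(u,w)$ be the set of labeled chains $C: u=v_0\xrightarrow{d_1}v_1\xrightarrow{d_2}\cdots\xrightarrow{d_p}v_p=w$ whose labels are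 weakly increasing for $\prec$, and for such $C$ write $\alpha(C)_i=\#\{j: d_j=i\}$ and $X_C=X_{d_1}\cdots X_{d_p}$. **Corollary.** Let $u,w\in S_\infty$ with $u\le w$, let $p=\ell(w)-\ell(u)$, and let $\prec$ be a total order on $\mathbb P$. The set of chains from $u$ to $w$, the set $\mathcal C_\prec(u,w)$ and the set $\{v: c^w_{uv}\ne0\}$ are finite; $\mathfrak D_{u,w}$ and all $\mathfrak D_v$ lie in $\mathbb C[X_1,X_2,\dots]$; and $$\mathfrak D_{u,w}=\sum_{C\in\mathcal C_\prec(u,w)}\frac1{\alpha(C)!}\,X_C=\sum_v c^w_{uv}\,\mathfrak D_v,$$ $$\overline{\mathfrak D_{u,w}}=\sum_{C\in\mathcal C_\prec(u,w)}\frac{p!}{(\alpha(C)!)^2}\,X_C=\sum_v c^w_{uv}\,\overline{\mathfrak D_v},$$ $$\widetilde{\mathfrak D_{u,w}}=\frac1{p!}\sum_{C\in\mathcal C_\prec(u,w)}X_C=\sum_v c^w_{uv}\,\widetilde{\mathfrak D_v}.$$ -/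

import Mathlib

namespace DualSchubert

open MvPolynomial

noncomputable section

/-! ### Permutations -/

/-- The group `S_∞` of permutations of the positive integers that fix all but finitely many
elements. The product is composition of functions. -/
def SInf : Subgroup (Equiv.Perm ℕ+) where
  carrier := {w | {i | w i ≠ i}.Finite}
  one_mem' := by simp
  mul_mem' := by
    intro v w hv hw
    refine (hv.union hw).subset ?_
    intro i hi
    by_contra h
    rw [Set.mem_union, not_or] at h
    have h1 : v i = i := not_not.mp h.1
    have h2 : w i = i := not_not.mp h.2
    exact hi (by simp [Equiv.Perm.mul_apply, h1, h2])
  inv_mem' := by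
    intro w hw
    refine Set.Finite.subset hw ?_
    intro i hi h
    exact hi (by rw [Equiv.Perm.inv_eq_iff_eq, h])

/-- The transposition `(a, b)`. -/
def transposition (a b : ℕ+) : SInf :=
  ⟨Equiv.swap a b, by
    refine (Set.toFinite {a, b}).subset ?_
    intro i hi
    by_contra h
    simp only [Set.mem_insert_iff, Set.mem_singleton_iff, not_or] at h
    exact hi (Equiv.swap_apply_of_ne_of_ne h.1 h.2)⟩

/-- The simple transposition `s_i = (i, i + 1)`. -/
def simpleTransposition (i : ℕ+) : SInf := transposition i (i + 1)

/-- The product `s_{a_1} ⋯ s_{a_p}` of a word `(a_1, …, a_p)`. -/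
def wordProd (a : List ℕ+) : SInf := (a.map simpleTransposition).prod

/-- The length `ℓ(w)`: the least number of simple transpositions whose product is `w`. -/
def length (w : SInf) : ℕ := sInf {p | ∃ a : List ℕ+, wordProd a = w ∧ a.length = p}

/-- The reduced words of `w`. -/
def reducedWords (w : SInf) : Set (List ℕ+) := {a | wordProd a = w ∧ a.length = length w}

/-! ### Bruhat order and chains -/

/-- The covers `u → v` of Bruhat order: `v = u (a, b)` with `ℓ(v) = ℓ(u) + 1`. -/
def Covers (u v : SInf) : Prop :=
  ∃ a b : ℕ+, a < b ∧ v = u * transposition a b ∧ length v = length u + 1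

/-- The `k`-Bruhat covers `u →ᵏ v`: covers `v = u (a, b)` with `a ≤ k < b`. -/
def KCovers (k : ℕ+) (u v : SInf) : Prop :=
  ∃ a b : ℕ+, a ≤ k ∧ k < b ∧ v = u * transposition a b ∧ length v = length u + 1

/-- Bruhat order `u ≤ w`: the reflexive transitive closure of the cover relation. -/
def BruhatLE (u w : SInf) : Prop := Relation.ReflTransGen Covers u w

/-- `IsChain u [v_1, …, v_p] w` says that `u = v_0 → v_1 → ⋯ → v_p = w` is a chain. -/
def IsChain : SInf → List SInf → SInf → Prop
  | u, [], w => u = w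
  | u, v :: C, w => Covers u v ∧ IsChain v C w

/-- `IsLabeledChain u [(k_1, v_1), …, (k_p, v_p)] w` says that `u = v_0 → v_1 → ⋯ → v_p = w`, where
`v_{i-1} → v_i` is a `k_i`-Bruhat cover, is a labeled chain. -/
def IsLabeledChain : SInf → List (ℕ+ × SInf) → SInf → Prop
  | u, [], w => u = w
  | u, (k, v) :: C, w => KCovers k u v ∧ IsLabeledChain v C w

/-- The set of chains from `u` to `w`. -/
def chains (u w : SInf) : Set (List SInf) := {C | IsChain u C w}

/-- The sequence of labels of a labeled chain. -/
def labels (C : List (ℕ+ × SInf)) : List ℕ+ := C.map Prod.fst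

/-- The set of labeled chains from `u` to `w` whose labels are weakly increasing for `≺`. -/
def increasingChains (prec : ℕ+ → ℕ+ → Prop) (u w : SInf) : Set (List (ℕ+ × SInf)) :=
  {C | IsLabeledChain u C w ∧ (labels C).Pairwise (fun d e => prec d e ∨ d = e)}

/-! ### Polynomials -/

/-- The polynomial ring `ℂ[x_1, x_2, …]`. -/
abbrev Poly : Type := MvPolynomial ℕ+ ℂ

/-- Biwords `[(i_1, a_1), …, (i_p, a_p)]` for which `(a_1, …, a_p)` is a reduced word of `w`,
`i_1 ≤ ⋯ ≤ i_p`, `i_j ≤ a_j`, and `i_j = i_{j+1}` only if `a_j > a_{j+1}`. -/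
def compatibleSequences (w : SInf) : Set (List (ℕ+ × ℕ+)) :=
  {R | R.map Prod.snd ∈ reducedWords w ∧ (∀ r ∈ R, r.1 ≤ r.2) ∧
    R.IsChain (fun r s => r.1 ≤ s.1 ∧ (r.1 = s.1 → s.2 < r.2))}

/-- The Schubert polynomial `𝔖_w`, by the formula of Billey, Jockusch and Stanley. -/
def schubert (w : SInf) : Poly :=
  ∑ᶠ R ∈ compatibleSequences w, (R.map fun r => (X r.1 : Poly)).prod

/-- The Littlewood-Richardson coefficient `c^w_{uv}`: the coefficient of `𝔖_w` in the expansion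
`𝔖_u 𝔖_v = ∑_w c^w_{uv} 𝔖_w`. (The Schubert polynomials are a basis of `ℂ[x_1, x_2, …]`, so there is
exactly one such expansion.) -/
def lrCoeff (u v w : SInf) : ℂ :=
  Classical.epsilon
    (fun c : SInf →₀ ℂ => schubert u * schubert v = c.sum fun w a => a • schubert w) w

theorem pderiv_pderiv_comm (i j : ℕ+) (f : Poly) :
    pderiv i (pderiv j f) = pderiv j (pderiv i f) := by
  have h : ⁅(pderiv i : Derivation ℂ Poly Poly), (pderiv j : Derivation ℂ Poly Poly)⁆ = 0 := by
    apply MvPolynomial.derivation_ext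
    intro k
    simp only [Derivation.commutator_apply, pderiv_X, Derivation.coe_zero, Pi.zero_apply]
    rcases eq_or_ne k i with rfl | hi <;> rcases eq_or_ne k j with rfl | hj <;>
      simp_all
  have := congrArg (fun D => D f) h
  simpa [Derivation.commutator_apply, sub_eq_zero] using this

instance : LeftCommutative (fun (i : ℕ+) (f : Poly) => pderiv i f) :=
  ⟨fun i j f => pderiv_pderiv_comm i j f⟩

/-- The partial derivative `∂^α g`, in which `∂/∂x_i` is applied `α_i` times for each `i`. -/
def iteratedPDeriv (α : ℕ+ →₀ ℕ) (g : Poly) : Poly :=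
  (Finsupp.toMultiset α).foldr (fun i f => pderiv i f) g

/-- The pairing `⟨f, g⟩ = f(∂/∂x_1, ∂/∂x_2, …) g |_{x = 0}`. -/
def pairing (f g : Poly) : ℂ :=
  ∑ α ∈ f.support, coeff α f * eval (fun _ => 0) (iteratedPDeriv α g)

open Classical in
/-- The dual Schubert polynomial `𝔇_w`: the polynomial with `⟨𝔖_u, 𝔇_w⟩ = δ_{uw}` for all `u`.
(There is exactly one, the Schubert polynomials being a basis.) -/
def dualSchubert (w : SInf) : Poly :=
  Classical.epsilon fun f : Poly => ∀ u, pairing (schubert u) f = if u = w then 1 else 0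

open Classical in
/-- The weight `μ(u → v) = x_a - x_b` where `v = u (a, b)` with `a < b`. -/
def weight (u v : SInf) : Poly :=
  if h : ∃ r : ℕ+ × ℕ+, r.1 < r.2 ∧ v = u * transposition r.1 r.2 then
    X h.choose.1 - X h.choose.2
  else 0

theorem weight_mul_transposition (u : SInf) {a b : ℕ+} (hab : a < b) :
    weight u (u * transposition a b) = X a - X b := by
  have h : ∃ r : ℕ+ × ℕ+, r.1 < r.2 ∧ u * transposition a b = u * transposition r.1 r.2 :=
    ⟨(a, b), hab, rfl⟩
  rw [weight, dif_pos h]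
  obtain ⟨h1, h2⟩ := h.choose_spec
  generalize h.choose = r at h1 h2
  have h3 : Equiv.swap a b = Equiv.swap r.1 r.2 := congrArg Subtype.val (mul_left_cancel h2)
  have ha := congrArg (fun e => e a) h3
  have hb := congrArg (fun e => e b) h3
  simp only [Equiv.swap_apply_left, Equiv.swap_apply_right, Equiv.swap_apply_def] at ha hb
  have : r.1 = a ∧ r.2 = b := by
    grind
  rw [this.1, this.2]

/-- The product of the weights of the steps of a chain that starts at `u`. -/
def chainWeight : SInf → List SInf → Poly
  | _, [] => 1
  | u, v :: C => weight u v * chainWeight v C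

/-- The skew dual Schubert polynomial `𝔇_{u,w}`. All chains from `u` to `w` have
`p = ℓ(w) - ℓ(u)` steps. -/
def skewDualSchubert (u w : SInf) : Poly :=
  ((Nat.factorial (length w - length u) : ℂ)⁻¹) • ∑ᶠ C ∈ chains u w, chainWeight u C

/-! ### Polynomials in the differences of the variables -/

/-- The difference `X_i = x_i - x_{i+1}`. -/
def diffVar (i : ℕ+) : Poly := X i - X (i + 1)

/-- The monomial `X^α = X_1^{α_1} X_2^{α_2} ⋯` in the differences. -/
def diffMonomial (α : ℕ+ →₀ ℕ) : Poly := α.prod fun i k => diffVar i ^ k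

/-- The subalgebra `ℂ[X_1, X_2, …]` of `ℂ[x_1, x_2, …]`. -/
def diffAlgebra : Subalgebra ℂ Poly := Algebra.adjoin ℂ (Set.range diffVar)

/-- The substitution of the differences for the variables. -/
def diffHom : Poly →ₐ[ℂ] Poly := aeval diffVar

theorem diffHom_injective : Function.Injective diffHom := by
  intro f g hfg
  obtain ⟨n, hn⟩ : ∃ n : ℕ+, ∀ i ∈ f.vars ∪ g.vars, i ≤ n :=
    (f.vars ∪ g.vars).bddAbove.imp fun n h i hi => h hi
  let Ψ : Poly →ₐ[ℂ] Poly := aeval fun i => ∑ j ∈ Finset.Icc i n, X j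
  have key : ∀ i ≤ n, Ψ (diffVar i) = X i := by
    intro i hi
    have h1 : Finset.Icc i n = insert i (Finset.Icc (i + 1) n) := by
      ext j
      simp only [Finset.mem_Icc, Finset.mem_insert, ← PNat.coe_le_coe, ← PNat.coe_inj,
        PNat.add_coe, PNat.one_coe] at hi ⊢
      omega
    have h2 : i ∉ Finset.Icc (i + 1) n := by
      simp only [Finset.mem_Icc, ← PNat.coe_le_coe, PNat.add_coe, PNat.one_coe]
      omega
    simp only [Ψ, diffVar, map_sub, aeval_X]
    rw [h1, Finset.sum_insert h2, add_sub_cancel_right]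
  have inv : ∀ q : Poly, (∀ i ∈ q.vars, i ≤ n) → Ψ (diffHom q) = q := by
    intro q hq
    have : (Ψ.comp diffHom) q = AlgHom.id ℂ Poly q := by
      apply MvPolynomial.hom_congr_vars (f₁ := (Ψ.comp diffHom).toRingHom)
        (f₂ := (AlgHom.id ℂ Poly).toRingHom)
      · ext <;> simp
      · intro i hi _
        simpa [diffHom] using key i (hq i hi)
      · rfl
    simpa using this
  rw [← inv f fun i hi => hn i (Finset.mem_union_left _ hi),
    ← inv g fun i hi => hn i (Finset.mem_union_right _ hi), hfg]

theorem diffHom_ker : LinearMap.ker diffHom.toLinearMap = ⊥ :=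
  LinearMap.ker_eq_bot.mpr diffHom_injective

/-- The linear map that multiplies each monomial `X^α` in the differences by `c α`. The monomials
`X^α` are linearly independent, with span `ℂ[X_1, X_2, …]`, so they determine it on this subalgebra;
its values at other polynomials, which depend on an arbitrary choice, are never used. -/
def rescale (c : (ℕ+ →₀ ℕ) → ℂ) : Poly →ₗ[ℂ] Poly :=
  diffHom.toLinearMap ∘ₗ
    (basisMonomials ℕ+ ℂ).constr ℂ (fun α => monomial α (c α)) ∘ₗ
      (LinearMap.exists_leftInverse_of_injective diffHom.toLinearMap diffHom_ker).choose

theorem diffHom_monomial (α : ℕ+ →₀ ℕ) (a : ℂ) :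
    diffHom (monomial α a) = a • diffMonomial α := by
  rw [diffHom, aeval_monomial, diffMonomial, Algebra.smul_def]

theorem rescale_diffMonomial (c : (ℕ+ →₀ ℕ) → ℂ) (α : ℕ+ →₀ ℕ) :
    rescale c (diffMonomial α) = c α • diffMonomial α := by
  have h := (LinearMap.exists_leftInverse_of_injective diffHom.toLinearMap diffHom_ker).choose_spec
  have h1 : diffMonomial α = diffHom.toLinearMap (monomial α 1) := by
    simp [diffHom_monomial]
  have h2 := LinearMap.congr_fun h (monomial α 1)
  rw [LinearMap.comp_apply, LinearMap.id_apply, ← h1] at h2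
  have h3 : (basisMonomials ℕ+ ℂ).constr ℂ (fun α => monomial α (c α)) (monomial α (1 : ℂ)) =
      monomial α (c α) := by
    have := (basisMonomials ℕ+ ℂ).constr_basis ℂ (fun α => monomial α (c α)) α
    rwa [coe_basisMonomials] at this
  rw [rescale, LinearMap.comp_apply, LinearMap.comp_apply, h2, h3]
  exact diffHom_monomial α (c α)

/-- The product `α! = α_1! α_2! ⋯`. -/
def multiFactorial (α : ℕ+ →₀ ℕ) : ℕ := α.prod fun _ k => Nat.factorial k

/-- The linear map with `X^α ↦ (p! / α!) X^α`, where `p = α_1 + α_2 + ⋯`. -/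
def bar : Poly →ₗ[ℂ] Poly :=
  rescale fun α => (Nat.factorial α.degree : ℂ) / (multiFactorial α : ℂ)

/-- The inverse scaling, `X^α ↦ (α! / p!) X^α`, where `p = α_1 + α_2 + ⋯`. -/
def barInv : Poly →ₗ[ℂ] Poly :=
  rescale fun α => (multiFactorial α : ℂ) / (Nat.factorial α.degree : ℂ)

/-- The content `α(d)` of a word: `α_i` is the number of `j` with `d_j = i`. -/
def content (d : List ℕ+) : ℕ+ →₀ ℕ := Multiset.toFinsupp (d : Multiset ℕ+)

/-- The product `X_{d_1} ⋯ X_{d_p}`. -/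
def wordMonomial (d : List ℕ+) : Poly := (d.map diffVar).prod

end

end DualSchubert

namespace DualSchubert

open MvPolynomial

noncomputable section

/-! ### The length of a permutation -/

/-! By Monk's formula, the coefficient of `𝔖_v` in `x_k 𝔖_u` is the coefficient of `x_k` in the
weight of the cover `u → v` (and 0 if there is no cover). Let `M_k` be the matrix of multiplication
by `x_k` in the Schubert basis. These matrices commute, and `M = ∑ x_k M_k` has the cover weights as
entries. The chains from `u` to `w` are the paths counted by powers of `M`, so `𝔇_{u,w}` is the `(u,
w)` entry of `exp M`. Commutativity gives `∂_k exp M = M_k exp M` (`pderiv_skewDualSchubert`). As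
`∂_k` is adjoint to multiplication by `x_k`, it follows that `⟨f, 𝔇_{u,w}⟩` is the coefficient of
`𝔖_w` in `f 𝔖_u` (`pairingHom_skewDualSchubert`).

Both expansions are read off from this. With `f = 𝔖_v` the pairing is `c^w_{uv}`, and with `u = 1`
it shows that `𝔇_w = 𝔇_{1,w}`; this is the expansion in dual Schubert polynomials. With `f` a
product of partial sums `x_1 + ⋯ + x_k`, Monk's formula makes the pairing the number of labeled
chains with a prescribed label word. The monomials in the partial sums are dual to the `X^α / α!`
(`pairingHom_aeval_diffHom`). Each `α` is the content of exactly one weakly increasing word, so the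
coefficient of `X^α / α!` in `𝔇_{u,w}` is the number of increasing chains of content `α`. The scaled
identities are images of these two under linear maps that are diagonal on the `X^α`.

Monk's formula itself rests on divided differences. The compatible-sequence formula presents `𝔖_w`
as a coefficient of a product in the nilCoxeter algebra (`aeval_schubert`). The Yang–Baxter relation
shows that a divided difference acts on this product as multiplication by a generator, so `∂_i 𝔖_w`
is `𝔖_{w s_i}` or 0. Induction on length then makes the two sides of Monk's formula differ by a
polynomial symmetric in infinitely many variables, hence by a constant, and that constant is 0
(`X_mul_schubert`). -/

/-- `w` fixes every integer greater than `N`. -/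
def FixesAbove (N : ℕ+) (w : SInf) : Prop := ∀ j, N < j → w.1 j = j

theorem exists_fixesAbove (w : SInf) : ∃ N, FixesAbove N w := by
  obtain ⟨N, hN⟩ := (show {i | w.1 i ≠ i}.Finite from w.2).bddAbove
  refine ⟨N, fun j hj => ?_⟩
  by_contra h
  exact absurd (hN h) (not_le.mpr hj)

theorem FixesAbove.le_of_inversion {N : ℕ+} {w : SInf} (h : FixesAbove N w) {a b : ℕ+}
    (hab : a < b) (hw : w.1 b < w.1 a) : b ≤ N := by
  by_contra hb
  rw [not_le] at hb
  rw [h b hb] at hw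
  have := w.1.injective (h (w.1 a) (hb.trans hw))
  rw [this] at hw
  exact absurd hab hw.not_gt

theorem coe_mul_transposition_apply (u : SInf) (a b x : ℕ+) :
    (u * transposition a b).1 x = u.1 (Equiv.swap a b x) := rfl

@[simp]
theorem coe_transposition (a b : ℕ+) : (transposition a b).1 = Equiv.swap a b := rfl

theorem transposition_mul_self (a b : ℕ+) : transposition a b * transposition a b = 1 :=
  Subtype.ext (Equiv.swap_mul_self a b)

theorem mul_transposition_cancel (u : SInf) (a b : ℕ+) :
    u * transposition a b * transposition a b = u := by
  rw [mul_assoc, transposition_mul_self, mul_one]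

theorem FixesAbove.mul_transposition {N : ℕ+} {w : SInf} (h : FixesAbove N w) {a b : ℕ+}
    (ha : a ≤ N) (hb : b ≤ N) : FixesAbove N (w * transposition a b) := by
  intro j hj
  rw [coe_mul_transposition_apply, Equiv.swap_apply_of_ne_of_ne, h j hj]
  · exact (ha.trans_lt hj).ne'
  · exact (hb.trans_lt hj).ne'

/-- The set of inversions of `w`. -/
def inversions (w : SInf) : Set (ℕ+ × ℕ+) := {p | p.1 < p.2 ∧ w.1 p.2 < w.1 p.1}

theorem finite_inversions (w : SInf) : (inversions w).Finite := by
  obtain ⟨N, hN⟩ := exists_fixesAbove w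
  refine ((Set.finite_Iic N).prod (Set.finite_Iic N)).subset fun p hp => ?_
  have := hN.le_of_inversion hp.1 hp.2
  exact ⟨hp.1.le.trans this, this⟩

/-- `w` has an ascent at `i`. -/
def Ascent (w : SInf) (i : ℕ+) : Prop := w.1 i < w.1 (i + 1)

theorem not_ascent {w : SInf} {i : ℕ+} : ¬ Ascent w i ↔ w.1 (i + 1) < w.1 i := by
  rw [Ascent, not_lt, le_iff_lt_or_eq]
  refine ⟨fun h => h.resolve_right fun h => ?_, Or.inl⟩
  exact (PNat.lt_add_right i 1).ne' (w.1.injective h)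

theorem ascent_mul_simple {w : SInf} {i : ℕ+} :
    Ascent (w * simpleTransposition i) i ↔ ¬ Ascent w i := by
  rw [not_ascent, Ascent, simpleTransposition, coe_mul_transposition_apply,
    coe_mul_transposition_apply, Equiv.swap_apply_left, Equiv.swap_apply_right]

theorem mul_simple_cancel (w : SInf) (i : ℕ+) :
    w * simpleTransposition i * simpleTransposition i = w := mul_transposition_cancel _ _ _

theorem swap_lt_swap {i a b : ℕ+} (hab : a < b) (h : ¬ (a = i ∧ b = i + 1)) :
    Equiv.swap i (i + 1) a < Equiv.swap i (i + 1) b := by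
  simp only [Equiv.swap_apply_def]
  simp only [← PNat.coe_lt_coe, ← PNat.coe_inj, PNat.add_coe, PNat.one_coe] at *
  split_ifs <;> (try simp only [PNat.add_coe, PNat.one_coe]) <;> omega

theorem inversions_mul_simple {w : SInf} {i : ℕ+} (h : Ascent w i) :
    inversions (w * simpleTransposition i) =
      insert (i, i + 1)
        (Prod.map (Equiv.swap i (i + 1)) (Equiv.swap i (i + 1)) '' inversions w) := by
  ext ⟨a, b⟩
  simp only [Set.mem_insert_iff, Set.mem_image, Prod.mk.injEq, Prod.exists, Prod.map]
  constructor
  · rintro ⟨hab, hw⟩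
    by_cases hi : a = i ∧ b = i + 1
    · exact Or.inl hi
    · exact Or.inr ⟨_, _, ⟨swap_lt_swap hab hi, hw⟩, by simp, by simp⟩
  · rintro (⟨rfl, rfl⟩ | ⟨c, d, ⟨hcd, hw⟩, rfl, rfl⟩)
    · refine ⟨PNat.lt_add_right _ _, ?_⟩
      simpa [simpleTransposition, coe_mul_transposition_apply, Ascent] using h
    · refine ⟨swap_lt_swap hcd ?_, ?_⟩
      · rintro ⟨rfl, rfl⟩
        exact absurd h hw.not_gt
      · simpa [simpleTransposition, coe_mul_transposition_apply] using hw

/-- At an ascent, `s_i` carries the old inversions injectively to new ones, and `(i, i + 1)` is the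
only addition. -/
theorem ncard_inversions_mul_simple {w : SInf} {i : ℕ+} (h : Ascent w i) :
    (inversions (w * simpleTransposition i)).ncard = (inversions w).ncard + 1 := by
  rw [inversions_mul_simple h, Set.ncard_insert_of_notMem _ ((finite_inversions w).image _),
    Set.ncard_image_of_injective _
      ((Equiv.swap i (i + 1)).injective.prodMap (Equiv.swap i (i + 1)).injective)]
  rintro ⟨⟨c, d⟩, ⟨hcd, -⟩, hp⟩
  simp only [Prod.map, Prod.mk.injEq, Equiv.swap_apply_eq_iff, Equiv.swap_apply_left,
    Equiv.swap_apply_right] at hp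
  rw [hp.1, hp.2] at hcd
  exact absurd (PNat.lt_add_right i 1) hcd.not_gt

theorem ncard_inversions_mul_simple' {w : SInf} {i : ℕ+} (h : ¬ Ascent w i) :
    (inversions (w * simpleTransposition i)).ncard + 1 = (inversions w).ncard := by
  rw [← ncard_inversions_mul_simple (ascent_mul_simple.mpr h), mul_simple_cancel]

theorem exists_not_ascent {w : SInf} (hw : w ≠ 1) : ∃ i, ¬ Ascent w i := by
  by_contra! h
  apply hw
  have h1 : StrictMono w.1 := by
    intro a b hab
    induction b using PNat.recOn with
    | one => exact (not_lt_one hab).elim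
    | succ b ih =>
      rcases (PNat.lt_add_one_iff.mp hab).lt_or_eq with h2 | rfl
      · exact (ih h2).trans (h b)
      · exact h _
  have h2 : StrictMono w.1.symm := by
    intro a b hab
    by_contra h3
    have := h1.monotone (not_lt.mp h3)
    simp only [Equiv.apply_symm_apply] at this
    exact absurd hab this.not_gt
  -- A strictly increasing self-map of the positive integers lies above the identity; this applies
  -- to `w` and to its inverse.
  refine Subtype.ext (Equiv.ext fun x => le_antisymm ?_ h1.le_apply)
  have := h2.le_apply (x := w.1 x)
  simpa using this

theorem wordProd_append_singleton (a : List ℕ+) (i : ℕ+) :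
    wordProd (a ++ [i]) = wordProd a * simpleTransposition i := by
  simp [wordProd]

theorem inversions_one : inversions 1 = ∅ := by
  ext ⟨a, b⟩
  simp only [inversions, Set.mem_ofPred_eq, Set.mem_empty_iff_false, iff_false, not_and, not_lt]
  exact le_of_lt

theorem ncard_inversions_wordProd_le (a : List ℕ+) :
    (inversions (wordProd a)).ncard ≤ a.length := by
  induction a using List.reverseRecOn with
  | nil => simp [wordProd, inversions_one]
  | append_singleton a i ih =>
    rw [wordProd_append_singleton, List.length_append, List.length_singleton]
    by_cases h : Ascent (wordProd a) i
    · have := ncard_inversions_mul_simple h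
      omega
    · have := ncard_inversions_mul_simple' h
      omega

/-- Bubble sort: each descent that is removed lowers the number of inversions by one. -/
theorem exists_wordProd_eq (w : SInf) :
    ∃ a, wordProd a = w ∧ a.length = (inversions w).ncard := by
  induction hn : (inversions w).ncard generalizing w with
  | zero =>
    refine ⟨[], ?_, rfl⟩
    by_contra h
    obtain ⟨i, hi⟩ := exists_not_ascent (w := w) (fun h1 => h (by simp [h1, wordProd]))
    have := ncard_inversions_mul_simple' hi
    omega
  | succ n ih =>
    obtain ⟨i, hi⟩ := exists_not_ascent (w := w) (by rintro rfl; simp [inversions_one] at hn)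
    have := ncard_inversions_mul_simple' hi
    obtain ⟨a, ha, hl⟩ := ih (w * simpleTransposition i) (by omega)
    exact ⟨a ++ [i], by rw [wordProd_append_singleton, ha, mul_simple_cancel], by simp [hl]⟩

theorem length_eq_ncard (w : SInf) : length w = (inversions w).ncard := by
  refine le_antisymm (Nat.sInf_le (exists_wordProd_eq w)) ?_
  refine le_csInf ⟨_, exists_wordProd_eq w⟩ ?_
  rintro p ⟨a, rfl, rfl⟩
  exact ncard_inversions_wordProd_le a

theorem length_mul_simple {w : SInf} {i : ℕ+} (h : Ascent w i) :
    length (w * simpleTransposition i) = length w + 1 := by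
  simp only [length_eq_ncard, ncard_inversions_mul_simple h]

theorem length_mul_simple' {w : SInf} {i : ℕ+} (h : ¬ Ascent w i) :
    length (w * simpleTransposition i) + 1 = length w := by
  simp only [length_eq_ncard, ncard_inversions_mul_simple' h]

theorem length_one : length 1 = 0 := by
  rw [length_eq_ncard, inversions_one, Set.ncard_empty]

theorem length_eq_zero {w : SInf} : length w = 0 ↔ w = 1 := by
  refine ⟨fun h => ?_, fun h => h ▸ length_one⟩
  by_contra hw
  obtain ⟨i, hi⟩ := exists_not_ascent hw
  have := length_mul_simple' hi
  omega

theorem length_wordProd_le (a : List ℕ+) : length (wordProd a) ≤ a.length :=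
  Nat.sInf_le ⟨a, rfl, rfl⟩

/-! ### Bruhat covers -/

theorem conj_transposition (a b : ℕ+) (i : ℕ+) :
    simpleTransposition i * transposition a b * simpleTransposition i =
      transposition (Equiv.swap i (i + 1) a) (Equiv.swap i (i + 1) b) := by
  refine Subtype.ext ?_
  change Equiv.swap i (i + 1) * Equiv.swap a b * Equiv.swap i (i + 1) = Equiv.swap _ _
  rw [Equiv.swap_apply_apply, Equiv.swap_inv]

/-- Induction on `b - a`, by conjugating `(a, b)` to `(a + 1, b)` with `s_a`. The two outer factors
change the length by one each. If the first lowers it, then `u (a + 1) < u a < u b`, and the last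
one raises it again. -/
theorem length_lt_length_mul_transposition {u : SInf} {a b : ℕ+} (hab : a < b)
    (hu : u.1 a < u.1 b) : length u < length (u * transposition a b) := by
  obtain ⟨k, rfl⟩ := (⟨b - a, (PNat.add_sub_of_lt hab).symm⟩ : ∃ k, b = a + k)
  clear hab
  induction k using PNat.recOn generalizing u a with
  | one =>
    have := length_mul_simple (show Ascent u a from hu)
    rw [simpleTransposition] at this
    omega
  | succ k ih =>
    set c := a + (k + 1) with hc
    have hc' : c = (a + 1) + k := by rw [hc, add_assoc, add_comm k 1]
    have hac : a ≠ c := (PNat.lt_add_right a (k + 1)).ne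
    have hac' : a + 1 ≠ c := by rw [hc']; exact (PNat.lt_add_right _ k).ne
    have haa : a ≠ a + 1 := (PNat.lt_add_right a 1).ne
    have h1 : u * transposition a c =
        u * simpleTransposition a * transposition (a + 1) c * simpleTransposition a := by
      rw [mul_assoc, mul_assoc, ← mul_assoc (simpleTransposition a), conj_transposition,
        Equiv.swap_apply_right, Equiv.swap_apply_of_ne_of_ne hac.symm hac'.symm]
    have h2 : length (u * simpleTransposition a) <
        length (u * simpleTransposition a * transposition (a + 1) c) := by
      rw [hc']
      apply ih
      rw [← hc', simpleTransposition, coe_mul_transposition_apply, coe_mul_transposition_apply,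
        Equiv.swap_apply_right, Equiv.swap_apply_of_ne_of_ne hac.symm hac'.symm]
      exact hu
    have h3 : ¬ Ascent u a →
        Ascent (u * simpleTransposition a * transposition (a + 1) c) a := by
      intro h
      rw [not_ascent] at h
      have h4 : u.1 (a + 1) < u.1 c := h.trans hu
      rw [Ascent]
      simp only [simpleTransposition, coe_mul_transposition_apply, Equiv.swap_apply_left]
      rwa [Equiv.swap_apply_of_ne_of_ne haa hac, Equiv.swap_apply_left,
        Equiv.swap_apply_of_ne_of_ne hac.symm hac'.symm]
    rw [h1]
    by_cases h : Ascent u a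
    · have h5 := length_mul_simple h
      by_cases h6 : Ascent (u * simpleTransposition a * transposition (a + 1) c) a
      · have := length_mul_simple h6
        omega
      · have := length_mul_simple' h6
        omega
    · have h5 := length_mul_simple' h
      have := length_mul_simple (h3 h)
      omega

theorem lt_of_length_lt {u : SInf} {a b : ℕ+} (hab : a < b)
    (h : length u < length (u * transposition a b)) : u.1 a < u.1 b := by
  by_contra hu
  have h1 : u.1 b < u.1 a :=
    lt_of_le_of_ne (not_lt.mp hu) fun h => hab.ne' (u.1.injective h)
  have := length_lt_length_mul_transposition (u := u * transposition a b) hab (by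
    simpa only [coe_mul_transposition_apply, Equiv.swap_apply_left, Equiv.swap_apply_right])
  rw [mul_transposition_cancel] at this
  omega

/-- Were there an intermediate value at `c`, then `(a, b) = (a, c) (a, b) (c, b)` would be a product
of three factors that each raise the length. -/
theorem not_between_of_length_eq {u : SInf} {a b c : ℕ+} (hac : a < c) (hcb : c < b)
    (h : length (u * transposition a b) = length u + 1) : ¬ (u.1 a < u.1 c ∧ u.1 c < u.1 b) := by
  rintro ⟨h1, h2⟩
  have e1 : u * transposition a c * transposition a b * transposition c b =
      u * transposition a b := by
    refine Subtype.ext (Equiv.ext fun x => ?_)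
    simp only [coe_mul_transposition_apply]
    congr 1
    have := hac.ne
    have := hcb.ne
    have := (hac.trans hcb).ne
    simp only [Equiv.swap_apply_def]
    split_ifs <;> simp_all
  have l1 := length_lt_length_mul_transposition hac h1
  have l2 := length_lt_length_mul_transposition (u := u * transposition a c) (hac.trans hcb) (by
    rw [coe_mul_transposition_apply, coe_mul_transposition_apply, Equiv.swap_apply_left,
      Equiv.swap_apply_of_ne_of_ne (hac.trans hcb).ne' hcb.ne']
    exact h2)
  have l3 := length_lt_length_mul_transposition
      (u := u * transposition a c * transposition a b) hcb (by
    simp only [coe_mul_transposition_apply, Equiv.swap_apply_right]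
    rw [Equiv.swap_apply_of_ne_of_ne hac.ne' hcb.ne, Equiv.swap_apply_right,
      Equiv.swap_apply_left]
    exact h1)
  rw [e1] at l3
  omega

/-- Since `(a, b)` is an inversion of the upper permutation, `b ≤ N`. Hence chains ending at `w`
never leave a fixed finite symmetric group, which is what makes the later sums finite. -/
theorem FixesAbove.of_mul_transposition {N : ℕ+} {u : SInf} {a b : ℕ+} (hab : a < b)
    (h : FixesAbove N (u * transposition a b))
    (hl : length u < length (u * transposition a b)) : FixesAbove N u ∧ b ≤ N := by
  have h1 := lt_of_length_lt hab hl
  have h2 : b ≤ N := h.le_of_inversion hab (by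
    simpa only [coe_mul_transposition_apply, Equiv.swap_apply_left, Equiv.swap_apply_right])
  refine ⟨?_, h2⟩
  rw [← mul_transposition_cancel u a b]
  exact h.mul_transposition (hab.le.trans h2) h2

theorem Covers.fixesAbove {N : ℕ+} {u v : SInf} (h : Covers u v) (hv : FixesAbove N v) :
    FixesAbove N u := by
  obtain ⟨a, b, hab, rfl, hl⟩ := h
  exact (hv.of_mul_transposition hab (by omega)).1

/-- A cover by another transposition can turn the ascent at `i` into a descent only if exactly one
of `a = i`, `b = i + 1` holds. In that case the value at the other of the two positions would lie
between `u a` and `u b`. -/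
theorem Covers.eq_mul_simple {u v : SInf} {i : ℕ+} (h : Covers u v) (hu : Ascent u i)
    (hv : ¬ Ascent v i) : v = u * simpleTransposition i := by
  obtain ⟨a, b, hab, rfl, hl⟩ := h
  have h1 := lt_of_length_lt hab (show length u < _ by omega)
  have hb : ∀ c, a < c → c < b → ¬ (u.1 a < u.1 c ∧ u.1 c < u.1 b) :=
    fun c h2 h3 => not_between_of_length_eq h2 h3 hl
  rw [not_ascent, coe_mul_transposition_apply, coe_mul_transposition_apply] at hv
  have hu' : u.1 i < u.1 (i + 1) := hu
  have hi : i < i + 1 := PNat.lt_add_right i 1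
  by_cases hai : a = i
  · subst hai
    rcases eq_or_ne b (a + 1) with rfl | hne
    · rfl
    · have h2 : a + 1 < b := lt_of_le_of_ne (PNat.add_one_le_iff.mpr hab) hne.symm
      rw [Equiv.swap_apply_left, Equiv.swap_apply_of_ne_of_ne hi.ne' h2.ne] at hv
      exact absurd ⟨hu', hv⟩ (hb _ hi h2)
  · by_cases hbi : b = i + 1
    · subst hbi
      have h2 : a < i := lt_of_le_of_ne (PNat.lt_add_one_iff.mp hab) hai
      rw [Equiv.swap_apply_right, Equiv.swap_apply_of_ne_of_ne h2.ne' hi.ne] at hv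
      exact absurd ⟨hv, hu'⟩ (hb _ h2 hi)
    · exfalso
      simp only [Equiv.swap_apply_def] at hv
      grind

/-! ### The nilCoxeter relations -/

/-- The nilCoxeter relations of type `A_∞`. -/
structure NilCoxeter {A : Type*} [Ring A] (u : ℕ+ → A) : Prop where
  sq (i) : u i * u i = 0
  comm {i j} : i + 1 < j → u i * u j = u j * u i
  braid (i) : u i * u (i + 1) * u i = u (i + 1) * u i * u (i + 1)

/-- The factor `1 + x u_i`. -/
def nilFactor {R A : Type*} [CommRing R] [Ring A] [Algebra R A] (u : ℕ+ → A) (i : ℕ+) (x : R) :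
    A := 1 + x • u i

/-- The product `(1 + x u_i) (1 + x u_{i+1}) ⋯ (1 + x u_{i+k-1})`. -/
def nilRow {R A : Type*} [CommRing R] [Ring A] [Algebra R A] (u : ℕ+ → A) :
    ℕ → ℕ+ → R → A
  | 0, _, _ => 1
  | k + 1, i, x => nilFactor u i x * nilRow u k (i + 1) x

/-- The product of the rows with parameters `y_{i+k-1}, …, y_{i+1}, y_i`, where the row with
parameter `y_j` has the factors with indices `j, …, i+k-1`. -/
def nilProd {R A : Type*} [CommRing R] [Ring A] [Algebra R A] (u : ℕ+ → A) :
    ℕ → ℕ+ → (ℕ+ → R) → A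
  | 0, _, _ => 1
  | k + 1, i, y => nilProd u k (i + 1) y * nilRow u (k + 1) i (y i)

namespace NilCoxeter

variable {R A : Type*} [CommRing R] [Ring A] [Algebra R A] {u : ℕ+ → A}

theorem factor_mul_factor (h : NilCoxeter u) (i : ℕ+) (x y : R) :
    nilFactor u i x * nilFactor u i y = nilFactor u i (x + y) := by
  simp only [nilFactor, mul_add, add_mul, mul_one, one_mul, smul_mul_smul_comm, h.sq, smul_zero,
    add_smul]
  abel

theorem factor_zero (i : ℕ+) : nilFactor u i (0 : R) = 1 := by simp [nilFactor]

theorem commute_gen_factor (h : NilCoxeter u) {i j : ℕ+} (hij : i + 1 < j) (y : R) :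
    Commute (u i) (nilFactor u j y) :=
  (Commute.one_right _).add_right (Commute.smul_right (h.comm hij) y)

theorem commute_gen_row (h : NilCoxeter u) {i j : ℕ+} (hij : i + 1 < j) (k : ℕ) (y : R) :
    Commute (u i) (nilRow u k j y) := by
  induction k generalizing j with
  | zero => exact Commute.one_right _
  | succ k ih =>
    exact (h.commute_gen_factor hij y).mul_right (ih (hij.trans (PNat.lt_add_right j 1)))

theorem commute_factor_row (h : NilCoxeter u) {i j : ℕ+} (hij : i + 1 < j) (k : ℕ) (x y : R) :
    Commute (nilFactor u i x) (nilRow u k j y) :=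
  (Commute.one_left _).add_left ((h.commute_gen_row hij k y).smul_left x)

theorem commute_gen_prod (h : NilCoxeter u) {i j : ℕ+} (hij : i + 1 < j) (k : ℕ) (y : ℕ+ → R) :
    Commute (u i) (nilProd u k j y) := by
  induction k generalizing j with
  | zero => exact Commute.one_right _
  | succ k ih =>
    exact (ih (hij.trans (PNat.lt_add_right j 1))).mul_right (h.commute_gen_row hij _ _)

theorem yangBaxter (h : NilCoxeter u) (i : ℕ+) (x y : R) :
    nilFactor u i x * nilFactor u (i + 1) (x + y) * nilFactor u i y =
      nilFactor u (i + 1) y * nilFactor u i (x + y) * nilFactor u (i + 1) x := by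
  have h1 := h.sq i
  have h2 := h.sq (i + 1)
  have h3 := h.braid i
  simp only [nilFactor, mul_add, add_mul, mul_one, one_mul, smul_mul_assoc, mul_smul_comm, h1, h2,
    h3, smul_zero, add_smul, smul_add]
  module

/-- The product of the rows with parameters `x` and `y` is a short front factor times the product of
the rows one shorter. The latter commute by induction (`expand`), and the front factor is symmetric
in `x` and `y` by Yang–Baxter (`swap`). -/
theorem commute_row (h : NilCoxeter u) (k : ℕ) (i : ℕ+) (x y : R) :
    Commute (nilRow u k i x) (nilRow u k i y) := by
  induction k generalizing i x y with
  | zero => exact Commute.one_right _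
  | succ k ih =>
    rcases k with _ | k
    · simp only [nilRow, mul_one, Commute, SemiconjBy, h.factor_mul_factor, add_comm]
    have row (x : R) : nilRow u k (i + 1 + 1) x =
        nilFactor u (i + 1) (-x) * nilRow u (k + 1) (i + 1) x := by
      rw [nilRow, ← mul_assoc, h.factor_mul_factor, neg_add_cancel, factor_zero, one_mul]
    have expand (x y : R) : nilRow u (k + 1 + 1) i x * nilRow u (k + 1 + 1) i y =
        nilFactor u i x * nilFactor u (i + 1) x * nilFactor u i y * nilFactor u (i + 1) (-x) *
          (nilRow u (k + 1) (i + 1) x * nilRow u (k + 1) (i + 1) y) := by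
      have hc := h.commute_factor_row (PNat.lt_add_right (i + 1) 1) k y x
      calc _ = nilFactor u i x * nilFactor u (i + 1) x *
            (nilRow u k (i + 1 + 1) x * nilFactor u i y) * nilRow u (k + 1) (i + 1) y := by
            simp only [nilRow, mul_assoc]
        _ = _ := by
            rw [← hc.eq, row]
            simp only [mul_assoc]
    have swap (x y : R) : nilFactor u i x * nilFactor u (i + 1) x * nilFactor u i y *
          nilFactor u (i + 1) (-x) =
        nilFactor u i y * nilFactor u (i + 1) y * nilFactor u i x * nilFactor u (i + 1) (-y) := by
      have hyb := h.yangBaxter i (x - y) y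
      rw [sub_add_cancel] at hyb
      have hx : nilFactor u i x = nilFactor u i y * nilFactor u i (x - y) := by
        rw [h.factor_mul_factor, add_sub_cancel]
      have hy : nilFactor u (i + 1) (-y) =
          nilFactor u (i + 1) (x - y) * nilFactor u (i + 1) (-x) := by
        rw [h.factor_mul_factor]
        congr 1
        ring
      calc _ = nilFactor u i y * (nilFactor u i (x - y) * nilFactor u (i + 1) x *
            nilFactor u i y) * nilFactor u (i + 1) (-x) := by
            conv_lhs => rw [hx]
            simp only [mul_assoc]
        _ = _ := by
            rw [hyb, hy]
            simp only [mul_assoc]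
    rw [Commute, SemiconjBy, expand, expand, swap, (ih (i + 1) x y).eq]

theorem prod_congr {k : ℕ} {i : ℕ+} {y z : ℕ+ → R} (hyz : ∀ j, i ≤ j → y j = z j) :
    nilProd u k i y = nilProd u k i z := by
  induction k generalizing i with
  | zero => rfl
  | succ k ih =>
    rw [nilProd, nilProd, hyz i le_rfl,
      ih fun j hj => hyz j ((PNat.lt_add_right i 1).le.trans hj)]

/-- The last two rows become two full rows once the missing factor at index `i` is supplied, at the
cost of its inverse. Full rows commute, so only that inverse feels the swap, and it contributes
`(y_i - y_{i+1}) u_i`. The earlier rows have indices at least `i + 2`, so `u_i` moves past them. -/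
theorem prod_sub_prod_swap_self (h : NilCoxeter u) (k : ℕ) (i : ℕ+) (y : ℕ+ → R) :
    nilProd u (k + 2) i y - nilProd u (k + 2) i (y ∘ Equiv.swap i (i + 1)) =
      (y i - y (i + 1)) • (u i * nilProd u (k + 2) i y) := by
  have h0 : nilProd u k (i + 1 + 1) (y ∘ Equiv.swap i (i + 1)) = nilProd u k (i + 1 + 1) y := by
    refine prod_congr fun j hj => ?_
    have h1 : i + 1 < j := (PNat.lt_add_right _ _).trans_le hj
    rw [Function.comp_apply, Equiv.swap_apply_of_ne_of_ne
      ((PNat.lt_add_right i 1).trans h1).ne' h1.ne']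
  have h1 (x z : R) : nilRow u (k + 1) (i + 1) z * nilRow u (k + 2) i x =
      nilFactor u i (-z) * (nilRow u (k + 2) i z * nilRow u (k + 2) i x) := by
    rw [← mul_assoc, nilRow.eq_def u (k + 2) i z, ← mul_assoc, h.factor_mul_factor,
      neg_add_cancel, factor_zero, one_mul]
  have h2 (z : R) : u i * nilFactor u i z = u i := by
    rw [nilFactor, mul_add, mul_one, mul_smul_comm, h.sq, smul_zero, add_zero]
  have hc := h.commute_gen_prod (PNat.lt_add_right (i + 1) 1) k y
  simp only [nilProd, h0, Function.comp_apply, Equiv.swap_apply_left, Equiv.swap_apply_right]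
  simp only [mul_assoc]
  rw [h1, h1, (h.commute_row (k + 2) i (y i) (y (i + 1))).eq, ← mul_sub, ← sub_mul,
    ← mul_assoc (u i), hc.eq, mul_assoc, ← mul_assoc (u i) (nilFactor u i _), h2]
  simp only [nilFactor, add_sub_add_left_eq_sub, ← sub_smul, smul_mul_assoc, mul_smul_comm]
  congr 1
  ring

/-- The product of all rows is divided-difference equivariant. -/
theorem prod_sub_prod_swap (h : NilCoxeter u) (k m : ℕ) {i j : ℕ+} (hij : (i : ℕ) = j + m)
    (y : ℕ+ → R) :
    nilProd u (k + 2 + m) j y - nilProd u (k + 2 + m) j (y ∘ Equiv.swap i (i + 1)) =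
      (y i - y (i + 1)) • (u i * nilProd u (k + 2 + m) j y) := by
  induction m generalizing j with
  | zero =>
    obtain rfl : i = j := PNat.coe_inj.mp hij
    exact h.prod_sub_prod_swap_self k i y
  | succ m ih =>
    have hj : Equiv.swap i (i + 1) j = j := by
      apply Equiv.swap_apply_of_ne_of_ne
      · rintro rfl
        omega
      · rintro rfl
        rw [PNat.add_coe, PNat.one_coe] at hij
        omega
    -- The rightmost row carries `y j` with `j < i`, so the swap does not affect it.
    rw [← add_assoc, nilProd, nilProd, Function.comp_apply, hj, ← sub_mul,
      ih (by rw [PNat.add_coe, PNat.one_coe]; omega), smul_mul_assoc, mul_assoc]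

end NilCoxeter

/-! ### The action of the nilCoxeter generators -/

/-- The action of a generator of the nilCoxeter algebra on the basis of permutations. -/
def nilAction (R : Type*) [CommRing R] (i : ℕ+) : Module.End R (SInf →₀ R) :=
  open Classical in
  Finsupp.lsum R fun w =>
    if Ascent w i then Finsupp.lsingle (w * simpleTransposition i) else 0

section

variable {R : Type*} [CommRing R]

theorem nilAction_of_ascent {w : SInf} {i : ℕ+} (h : Ascent w i) (a : R) :
    nilAction R i (Finsupp.single w a) = Finsupp.single (w * simpleTransposition i) a := by
  simp [nilAction, h]

theorem nilAction_of_not_ascent {w : SInf} {i : ℕ+} (h : ¬ Ascent w i) (a : R) :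
    nilAction R i (Finsupp.single w a) = 0 := by
  simp [nilAction, h]

theorem simple_comm {i j : ℕ+} (hij : i + 1 < j) :
    simpleTransposition i * simpleTransposition j =
      simpleTransposition j * simpleTransposition i := by
  refine Subtype.ext ?_
  change Equiv.swap i (i + 1) * Equiv.swap j (j + 1) = Equiv.swap j (j + 1) * Equiv.swap i (i + 1)
  have h1 := hij.ne
  have h2 := ((PNat.lt_add_right i 1).trans hij).ne
  have h3 := (hij.trans (PNat.lt_add_right j 1)).ne
  have h4 := (((PNat.lt_add_right i 1).trans hij).trans (PNat.lt_add_right j 1)).ne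
  exact (Equiv.Perm.disjoint_swap_swap (by simp [*, ne_of_lt])).commute.eq

theorem simple_braid (i : ℕ+) :
    simpleTransposition i * simpleTransposition (i + 1) * simpleTransposition i =
      simpleTransposition (i + 1) * simpleTransposition i * simpleTransposition (i + 1) := by
  have h1 := (PNat.lt_add_right i 1).ne
  have h2 := (PNat.lt_add_right (i + 1) 1).ne
  have h3 := ((PNat.lt_add_right i 1).trans (PNat.lt_add_right (i + 1) 1)).ne
  conv_lhs => rw [simpleTransposition.eq_def (i + 1), conj_transposition, Equiv.swap_apply_right,
    Equiv.swap_apply_of_ne_of_ne h3.symm h2.symm]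
  conv_rhs => rw [simpleTransposition.eq_def i, conj_transposition, Equiv.swap_apply_left,
    Equiv.swap_apply_of_ne_of_ne h1 h3]

theorem ascent_mul_simple_of_ne {w : SInf} {i j : ℕ+} (hij : i + 1 < j ∨ j + 1 < i) :
    Ascent (w * simpleTransposition i) j ↔ Ascent w j := by
  rw [Ascent, simpleTransposition, coe_mul_transposition_apply, coe_mul_transposition_apply,
    Equiv.swap_apply_of_ne_of_ne, Equiv.swap_apply_of_ne_of_ne, Ascent]
  all_goals
    simp only [← PNat.coe_lt_coe, ← PNat.coe_inj, PNat.add_coe, PNat.one_coe, ne_eq] at *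
    omega

theorem nilCoxeter_nilAction : NilCoxeter (nilAction R) where
  sq i := by
    ext w : 2
    simp only [LinearMap.comp_apply, Finsupp.lsingle_apply, Module.End.mul_apply]
    by_cases h : Ascent w i
    · rw [nilAction_of_ascent h, nilAction_of_not_ascent]
      · rfl
      · rw [ascent_mul_simple]
        exact not_not.mpr h
    · rw [nilAction_of_not_ascent h, map_zero]
      rfl
  comm {i j} hij := by
    ext w : 2
    simp only [LinearMap.comp_apply, Finsupp.lsingle_apply, Module.End.mul_apply]
    have h1 := ascent_mul_simple_of_ne (w := w) (Or.inl hij)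
    have h2 := ascent_mul_simple_of_ne (w := w) (Or.inr hij)
    by_cases hi : Ascent w i <;> by_cases hj : Ascent w j <;>
      simp [hi, hj, h1, h2, nilAction_of_ascent, nilAction_of_not_ascent, mul_assoc,
        simple_comm hij]
  braid i := by
    ext w : 2
    simp only [LinearMap.comp_apply, Finsupp.lsingle_apply, Module.End.mul_apply]
    have h1 := (PNat.lt_add_right i 1).ne
    have h2 := (PNat.lt_add_right (i + 1) 1).ne
    have h3 := ((PNat.lt_add_right i 1).trans (PNat.lt_add_right (i + 1) 1)).ne
    have a1 : Ascent (w * simpleTransposition i) (i + 1) ↔ w.1 i < w.1 (i + 1 + 1) := by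
      rw [Ascent, simpleTransposition, coe_mul_transposition_apply, coe_mul_transposition_apply,
        Equiv.swap_apply_right, Equiv.swap_apply_of_ne_of_ne h3.symm h2.symm]
    have a2 : Ascent (w * simpleTransposition (i + 1)) i ↔ w.1 i < w.1 (i + 1 + 1) := by
      rw [Ascent, simpleTransposition, coe_mul_transposition_apply, coe_mul_transposition_apply,
        Equiv.swap_apply_left, Equiv.swap_apply_of_ne_of_ne h1 h3]
    have a3 : Ascent (w * simpleTransposition i * simpleTransposition (i + 1)) i ↔
        Ascent w (i + 1) := by
      simp only [Ascent, simpleTransposition, coe_mul_transposition_apply]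
      rw [Equiv.swap_apply_left, Equiv.swap_apply_of_ne_of_ne h1 h3, Equiv.swap_apply_left,
        Equiv.swap_apply_of_ne_of_ne h3.symm h2.symm]
    have a4 : Ascent (w * simpleTransposition (i + 1) * simpleTransposition i) (i + 1) ↔
        Ascent w i := by
      simp only [Ascent, simpleTransposition, coe_mul_transposition_apply]
      rw [Equiv.swap_apply_right, Equiv.swap_apply_of_ne_of_ne h3.symm h2.symm,
        Equiv.swap_apply_right, Equiv.swap_apply_of_ne_of_ne h1 h3]
    have a5 : Ascent w i → Ascent w (i + 1) → w.1 i < w.1 (i + 1 + 1) := lt_trans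
    -- Both sides vanish unless `w` increases on the positions `i`, `i + 1`, `i + 2`; in that case
    -- the braid relation of the group finishes.
    by_cases c1 : Ascent w i <;> by_cases c2 : Ascent w (i + 1) <;>
      by_cases c3 : w.1 i < w.1 (i + 1 + 1) <;>
      simp_all [nilAction_of_ascent, nilAction_of_not_ascent]
    simp only [mul_assoc]
    rw [← mul_assoc (simpleTransposition i), simple_braid, mul_assoc]

end

/-! ### Schubert polynomials as coefficients -/

/-- The pairs `(v, i), (v, i + 1), …, (v, i + k - 1)`. -/
def rowPairs (v : ℕ+) : ℕ → ℕ+ → List (ℕ+ × ℕ+)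
  | 0, _ => []
  | k + 1, i => (v, i) :: rowPairs v k (i + 1)

/-- The pairs `(v, a)` with `i ≤ v ≤ a < i + k`, by decreasing `v` and then increasing `a`. -/
def trianglePairs : ℕ → ℕ+ → List (ℕ+ × ℕ+)
  | 0, _ => []
  | k + 1, i => trianglePairs k (i + 1) ++ rowPairs i (k + 1) i

theorem mem_rowPairs {v : ℕ+} {k : ℕ} {i : ℕ+} {r : ℕ+ × ℕ+} :
    r ∈ rowPairs v k i ↔ r.1 = v ∧ i ≤ r.2 ∧ (r.2 : ℕ) < i + k := by
  induction k generalizing i with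
  | zero =>
    simp only [rowPairs, List.not_mem_nil, ← PNat.coe_le_coe, false_iff]
    omega
  | succ k ih =>
    obtain ⟨a, b⟩ := r
    simp only [rowPairs, List.mem_cons, ih, Prod.mk.injEq, ← PNat.coe_le_coe, ← PNat.coe_inj,
      PNat.add_coe, PNat.one_coe]
    omega

theorem mem_trianglePairs {k : ℕ} {i : ℕ+} {r : ℕ+ × ℕ+} :
    r ∈ trianglePairs k i ↔ i ≤ r.1 ∧ r.1 ≤ r.2 ∧ (r.2 : ℕ) < i + k := by
  induction k generalizing i with
  | zero =>
    simp only [trianglePairs, List.not_mem_nil, ← PNat.coe_le_coe, false_iff]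
    omega
  | succ k ih =>
    simp only [trianglePairs, List.mem_append, ih, mem_rowPairs, ← PNat.coe_le_coe,
      ← PNat.coe_inj, PNat.add_coe, PNat.one_coe]
    omega

/-- The order in which the pairs of a compatible sequence increase strictly. -/
def pairLT (r s : ℕ+ × ℕ+) : Prop := r.1 ≤ s.1 ∧ (r.1 = s.1 → s.2 < r.2)

theorem pairLT_trans {r s t : ℕ+ × ℕ+} (h1 : pairLT r s) (h2 : pairLT s t) : pairLT r t := by
  refine ⟨h1.1.trans h2.1, fun h => ?_⟩
  have h3 : r.1 = s.1 := le_antisymm h1.1 (h ▸ h2.1)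
  exact (h2.2 (h3 ▸ h)).trans (h1.2 h3)

theorem pairLT_irrefl (r : ℕ+ × ℕ+) : ¬ pairLT r r := fun h => (h.2 rfl).false

instance : Trans pairLT pairLT pairLT := ⟨pairLT_trans⟩

theorem pairwise_rowPairs (v : ℕ+) (k : ℕ) (i : ℕ+) :
    (rowPairs v k i).Pairwise (fun r s => pairLT s r) := by
  induction k generalizing i with
  | zero => exact List.Pairwise.nil
  | succ k ih =>
    refine List.Pairwise.cons (fun r hr => ?_) (ih _)
    rw [mem_rowPairs] at hr
    exact ⟨hr.1.le, fun _ => (PNat.lt_add_right i 1).trans_le hr.2.1⟩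

theorem pairwise_trianglePairs (k : ℕ) (i : ℕ+) :
    (trianglePairs k i).Pairwise (fun r s => pairLT s r) := by
  induction k generalizing i with
  | zero => exact List.Pairwise.nil
  | succ k ih =>
    refine List.pairwise_append.mpr ⟨ih _, pairwise_rowPairs _ _ _, fun r hr s hs => ?_⟩
    rw [mem_trianglePairs] at hr
    rw [mem_rowPairs] at hs
    have : s.1 < r.1 := hs.1 ▸ (PNat.lt_add_right i 1).trans_le hr.1
    exact ⟨this.le, fun h => absurd h this.ne⟩

theorem nodup_trianglePairs (k : ℕ) (i : ℕ+) : (trianglePairs k i).Nodup :=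
  (pairwise_trianglePairs k i).imp fun {r s} h => by
    rintro rfl
    exact pairLT_irrefl _ h

theorem prod_map_one_add {A β : Type*} [Semiring A] (f : β → A) (l : List β) :
    (l.map fun b => 1 + f b).prod = (l.sublists'.map fun s => (s.map f).prod).sum := by
  induction l with
  | nil => simp
  | cons b l ih =>
    rw [List.map_cons, List.prod_cons, ih, List.sublists'_cons, List.map_append, List.sum_append,
      add_mul, one_mul, List.map_map, ← List.sum_map_mul_left]
    simp [Function.comp_def]

section

variable {R A : Type*} [CommRing R] [Ring A] [Algebra R A] (u : ℕ+ → A)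

theorem nilRow_eq (k : ℕ) (i v : ℕ+) (y : ℕ+ → R) :
    nilRow u k i (y v) = ((rowPairs v k i).map fun r => 1 + y r.1 • u r.2).prod := by
  induction k generalizing i with
  | zero => rfl
  | succ k ih => rw [nilRow, rowPairs, List.map_cons, List.prod_cons, ih, nilFactor]

theorem nilProd_eq (k : ℕ) (i : ℕ+) (y : ℕ+ → R) :
    nilProd u k i y = ((trianglePairs k i).map fun r => 1 + y r.1 • u r.2).prod := by
  induction k generalizing i with
  | zero => rfl
  | succ k ih =>
    rw [nilProd, trianglePairs, List.map_append, List.prod_append, ih, nilRow_eq]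

theorem prod_map_smul {β : Type*} (c : β → R) (f : β → A) (l : List β) :
    (l.map fun b => c b • f b).prod = (l.map c).prod • (l.map f).prod := by
  induction l with
  | nil => simp
  | cons b l ih =>
    rw [List.map_cons, List.prod_cons, ih, smul_mul_smul_comm, List.map_cons, List.map_cons,
      List.prod_cons, List.prod_cons]

open Classical in
-- The leftmost generator acts last, on the right of the permutation, so the word is read backwards.
-- The result survives exactly when every step is an ascent, that is, when the word is reduced.
theorem prod_nilAction_single_one (a : List ℕ+) :
    (a.map (nilAction R)).prod (Finsupp.single 1 1) =
      if length (wordProd a.reverse) = a.length then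
        Finsupp.single (wordProd a.reverse) (1 : R) else 0 := by
  induction a with
  | nil => simp [wordProd, length_one]
  | cons i a ih =>
    rw [List.map_cons, List.prod_cons, Module.End.mul_apply, ih, List.reverse_cons,
      wordProd_append_singleton, List.length_cons]
    have hle := length_wordProd_le a.reverse
    rw [List.length_reverse] at hle
    by_cases h : Ascent (wordProd a.reverse) i
    · have := length_mul_simple h
      by_cases hl : length (wordProd a.reverse) = a.length
      · rw [if_pos hl, if_pos (by omega), nilAction_of_ascent h]
      · rw [if_neg hl, if_neg (by omega), map_zero]
    · have := length_mul_simple' h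
      rw [if_neg (c := length (_ * _) = _) (by omega)]
      split_ifs
      · exact nilAction_of_not_ascent h _
      · exact map_zero _

end

open Classical in
theorem nilProd_nilAction_coeff {R : Type*} [CommRing R] (k : ℕ) (i : ℕ+) (y : ℕ+ → R)
    (w : SInf) :
    nilProd (nilAction R) k i y (Finsupp.single 1 1) w =
      ∑ s ∈ (trianglePairs k i).sublists'.toFinset,
        if s.reverse.map Prod.snd ∈ reducedWords w then (s.map fun r => y r.1).prod else 0 := by
  rw [nilProd_eq, prod_map_one_add, List.sum_toFinset _
    (List.nodup_sublists'.mpr (nodup_trianglePairs k i))]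
  generalize (trianglePairs k i).sublists' = L
  induction L with
  | nil => simp
  | cons s L ih =>
    rw [List.map_cons, List.map_cons, List.sum_cons, List.sum_cons, ← ih, LinearMap.add_apply,
      Finsupp.add_apply]
    congr 1
    have := prod_nilAction_single_one (R := R) (s.map Prod.snd)
    rw [prod_map_smul (fun r : ℕ+ × ℕ+ => y r.1) (fun r => nilAction R r.2), LinearMap.smul_apply]
    rw [List.map_map] at this
    simp only [Function.comp_def] at this
    rw [this, ← List.map_reverse, List.length_map]
    simp only [reducedWords, Set.mem_ofPred_eq, List.length_map, List.length_reverse]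
    generalize wordProd (List.map Prod.snd s.reverse) = v
    by_cases h1 : v = w
    · subst h1
      by_cases h2 : length v = s.length
      · simp [h2]
      · simp [h2, Ne.symm h2]
    · by_cases h2 : length v = s.length <;> simp [h1, h2]

/-- The last letter of a reduced word is a descent of `w`, and a permutation that fixes everything
above `N` has its descents below `N`. -/
theorem le_of_mem_reducedWords {N : ℕ+} {w : SInf} (hw : FixesAbove N w) {a : List ℕ+}
    (ha : a ∈ reducedWords w) : ∀ i ∈ a, i < N := by
  induction a using List.reverseRecOn generalizing w with
  | nil => simp
  | append_singleton a i ih =>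
    obtain ⟨h1, h2⟩ := ha
    rw [wordProd_append_singleton] at h1
    rw [List.length_append, List.length_singleton] at h2
    have h3 : wordProd a = w * simpleTransposition i := by rw [← h1, mul_simple_cancel]
    have h4 := length_wordProd_le a
    have h5 : ¬ Ascent w i := by
      intro h
      have := length_mul_simple h
      rw [h3] at h4
      omega
    have h6 := length_mul_simple' h5
    have h8 : length (w * simpleTransposition i) = a.length := by omega
    have h7 : i < N :=
      PNat.add_one_le_iff.mp (hw.le_of_inversion (PNat.lt_add_right i 1) (not_ascent.mp h5))
    intro j hj
    rcases List.mem_append.mp hj with hj | hj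
    · exact ih (hw.mul_transposition h7.le (PNat.add_one_le_iff.mpr h7)) ⟨h3, h8.symm⟩ j hj
    · rw [List.mem_singleton] at hj
      exact hj ▸ h7

open Classical in
-- Expanding the product of factors `1 + y_v u_a` gives a sum over sublists of the triangle of
-- pairs. That triangle is strictly sorted, so its sublists are the reversals of the strictly sorted
-- lists of its pairs; those whose letters form a reduced word of `w` are the compatible sequences.
theorem aeval_schubert {R : Type*} [CommRing R] [Algebra ℂ R] {N : ℕ+} {w : SInf}
    (hw : FixesAbove N w) {k : ℕ} (hk : (N : ℕ) ≤ k + 1) (y : ℕ+ → R) :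
    aeval y (schubert w) = nilProd (nilAction R) k 1 y (Finsupp.single 1 1) w := by
  rw [nilProd_nilAction_coeff, ← Finset.sum_filter]
  set T := (trianglePairs k 1).sublists'.toFinset.filter
    fun s => s.reverse.map Prod.snd ∈ reducedWords w with hT
  have hbij : Set.BijOn List.reverse (compatibleSequences w) (T : Set (List (ℕ+ × ℕ+))) := by
    refine ⟨fun R hR => ?_, List.reverse_injective.injOn, fun s hs => ⟨s.reverse, ?_, by simp⟩⟩
    · obtain ⟨h1, h2, h3⟩ := hR
      have h3' : R.Pairwise pairLT := List.isChain_iff_pairwise.mp h3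
      simp only [hT, Finset.coe_filter, List.mem_toFinset, List.mem_sublists', Set.mem_ofPred_eq,
        List.reverse_reverse, h1, and_true]
      have h4 : R.reverse.Pairwise (fun r s => pairLT s r) := List.pairwise_reverse.mpr h3'
      have h5 : R.reverse.Nodup := h4.imp fun {r s} h => by
        rintro rfl
        exact pairLT_irrefl _ h
      have h6 : R.reverse ⊆ trianglePairs k 1 := by
        intro r hr
        rw [List.mem_reverse] at hr
        refine mem_trianglePairs.mpr ⟨one_le, h2 r hr, ?_⟩
        have := le_of_mem_reducedWords hw h1 r.2 (List.mem_map_of_mem hr)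
        rw [← PNat.coe_lt_coe] at this
        rw [PNat.one_coe]
        omega
      have : Std.Antisymm (fun r s => pairLT s r) :=
        ⟨fun r s h1 h2 => (pairLT_irrefl _ (pairLT_trans h1 h2)).elim⟩
      -- Between lists sorted by the same strict order, inclusion of elements already gives a
      -- sublist.
      exact List.sublist_of_subperm_of_pairwise (List.subperm_of_subset h5 h6) h4
        (pairwise_trianglePairs k 1)
    · simp only [hT, Finset.coe_filter, List.mem_toFinset, List.mem_sublists', Set.mem_ofPred_eq]
        at hs
      refine ⟨hs.2, fun r hr => ?_, ?_⟩
      · exact (mem_trianglePairs.mp (hs.1.subset (List.mem_reverse.mp hr))).2.1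
      · exact (List.isChain_iff_pairwise (R := pairLT)).mpr
          (List.pairwise_reverse.mpr ((pairwise_trianglePairs k 1).sublist hs.1))
  rw [schubert, finsum_mem_eq_of_bijOn (g := fun s => (s.map fun r => (X r.1 : Poly)).prod)
    List.reverse hbij, finsum_mem_coe_finset, map_sum]
  · refine Finset.sum_congr rfl fun s _ => ?_
    rw [map_list_prod, List.map_map]
    simp [Function.comp_def]
  · intro R _
    rw [List.map_reverse, List.prod_reverse]

open Classical in
theorem nilAction_apply_of_ascent {R : Type*} [CommRing R] {w : SInf} {i : ℕ+} (h : Ascent w i)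
    (m : SInf →₀ R) : nilAction R i m w = 0 := by
  induction m using Finsupp.induction_linear with
  | zero => simp
  | add f g hf hg => rw [map_add, Finsupp.add_apply, hf, hg, add_zero]
  | single v a =>
    by_cases hv : Ascent v i
    · rw [nilAction_of_ascent hv, Finsupp.single_apply, if_neg]
      rintro rfl
      exact ascent_mul_simple.mp h hv
    · rw [nilAction_of_not_ascent hv, Finsupp.zero_apply]

open Classical in
theorem nilAction_apply_of_not_ascent {R : Type*} [CommRing R] {w : SInf} {i : ℕ+}
    (h : ¬ Ascent w i) (m : SInf →₀ R) :
    nilAction R i m w = m (w * simpleTransposition i) := by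
  induction m using Finsupp.induction_linear with
  | zero => simp
  | add f g hf hg => rw [map_add, Finsupp.add_apply, hf, hg, Finsupp.add_apply]
  | single v a =>
    by_cases hv : Ascent v i
    · rw [nilAction_of_ascent hv, Finsupp.single_apply, Finsupp.single_apply]
      congr 1
      rw [eq_iff_iff]
      constructor
      · rintro rfl
        exact (mul_simple_cancel v i).symm
      · rintro rfl
        exact mul_simple_cancel w i
    · rw [nilAction_of_not_ascent hv, Finsupp.zero_apply, Finsupp.single_apply, if_neg]
      rintro rfl
      exact hv (ascent_mul_simple.mpr h)

/-- The same product computes `𝔖_w` at the variables and at the variables swapped by `s_i`, so the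
divided difference becomes the action of the generator `i`. -/
theorem schubert_sub_rename (w : SInf) (i : ℕ+) :
    ∃ (N : ℕ+) (k : ℕ), FixesAbove N (w * simpleTransposition i) ∧ (N : ℕ) ≤ k + 1 ∧
      schubert w - rename (Equiv.swap i (i + 1)) (schubert w) = (X i - X (i + 1)) *
        nilAction Poly i (nilProd (nilAction Poly) k 1 (X : ℕ+ → Poly) (Finsupp.single 1 1)) w := by
  obtain ⟨N, hN⟩ := exists_fixesAbove w
  obtain ⟨M, hM⟩ := exists_fixesAbove (w * simpleTransposition i)
  -- The size must be large enough for `w` and for `w s_i`, and of the form `k + 2 + (i - 1)`, so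
  -- that at least two rows remain from index `i` on.
  refine ⟨M, (N + M + 2 + i.natPred : ℕ), hM, by omega, ?_⟩
  have h1 := aeval_schubert hN (k := (N + M + 2 + i.natPred : ℕ)) (by omega) (X : ℕ+ → Poly)
  have h2 := aeval_schubert hN (k := (N + M + 2 + i.natPred : ℕ)) (by omega)
    (X ∘ Equiv.swap i (i + 1) : ℕ+ → Poly)
  rw [aeval_X_left_apply] at h1
  have h3 : aeval (X ∘ Equiv.swap i (i + 1) : ℕ+ → Poly) (schubert w) =
      rename (Equiv.swap i (i + 1)) (schubert w) := by
    rw [← aeval_rename (g := (X : ℕ+ → Poly)), aeval_X_left_apply]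
  have h4 := (nilCoxeter_nilAction (R := Poly)).prod_sub_prod_swap (N + M : ℕ) i.natPred
    (i := i) (j := 1) (by rw [PNat.one_coe, PNat.one_add_natPred]) (X : ℕ+ → Poly)
  rw [← h3, h2, h1, ← Finsupp.sub_apply, ← LinearMap.sub_apply, h4]
  rfl

theorem rename_schubert_of_ascent {w : SInf} {i : ℕ+} (h : Ascent w i) :
    rename (Equiv.swap i (i + 1)) (schubert w) = schubert w := by
  obtain ⟨N, k, -, -, h1⟩ := schubert_sub_rename w i
  rw [nilAction_apply_of_ascent h, mul_zero, sub_eq_zero] at h1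
  exact h1.symm

theorem schubert_sub_rename_of_not_ascent {w : SInf} {i : ℕ+} (h : ¬ Ascent w i) :
    schubert w - rename (Equiv.swap i (i + 1)) (schubert w) =
      (X i - X (i + 1)) * schubert (w * simpleTransposition i) := by
  obtain ⟨N, k, hN, hk, h1⟩ := schubert_sub_rename w i
  rw [h1, nilAction_apply_of_not_ascent h, ← aeval_schubert hN hk, aeval_X_left_apply]

/-! ### Monk's formula -/

open Classical in
/-- The coefficient of `𝔖_v` in `x_k 𝔖_u`. -/
def monkCoeff (k : ℕ+) (u v : SInf) : ℂ :=
  if Covers u v then coeff (Finsupp.single k 1) (weight u v) else 0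

theorem monkCoeff_mul_transposition {k a b : ℕ+} {u : SInf} (hab : a < b)
    (h : length (u * transposition a b) = length u + 1) :
    monkCoeff k u (u * transposition a b) =
      (if a = k then 1 else 0) - (if b = k then 1 else 0) := by
  rw [monkCoeff, if_pos ⟨a, b, hab, rfl, h⟩, weight_mul_transposition u hab, coeff_sub, coeff_X,
    coeff_X]
  simp only [Finsupp.single_left_inj one_ne_zero]

theorem monkCoeff_of_not_covers {k : ℕ+} {u v : SInf} (h : ¬ Covers u v) : monkCoeff k u v = 0 :=
  if_neg h

theorem covers_of_monkCoeff_ne_zero {k : ℕ+} {u v : SInf} (h : monkCoeff k u v ≠ 0) :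
    Covers u v := by
  by_contra h'
  exact h (if_neg h')

/-- A nonzero coefficient forces `a = k` or `b = k`. For `b` far beyond `N` and `k` this leaves `a =
k`, and then the fixed point `b - 1` has an intermediate value, so there is no cover. -/
theorem finite_monkCoeff_ne_zero (k : ℕ+) (u : SInf) :
    (Function.support (monkCoeff k u)).Finite := by
  obtain ⟨N, hN⟩ := exists_fixesAbove u
  refine (((Set.finite_Iic (max N k + 1)).prod (Set.finite_Iic (max N k + 1))).image
    fun r => u * transposition r.1 r.2).subset fun v hv => ?_
  obtain ⟨a, b, hab, rfl, hl⟩ := covers_of_monkCoeff_ne_zero hv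
  rw [Function.mem_support, monkCoeff_mul_transposition hab hl] at hv
  suffices hb : b ≤ max N k + 1 from ⟨(a, b), ⟨hab.le.trans hb, hb⟩, rfl⟩
  by_contra hb
  rw [not_le] at hb
  have hk : k < b := (le_max_right N k).trans_lt ((PNat.lt_add_right _ 1).trans hb)
  have ha : a = k := by
    by_contra ha
    simp [ha, hk.ne'] at hv
  subst ha
  have hc : (max N a : ℕ+) + 1 < b := hb
  obtain ⟨c, rfl⟩ := PNat.exists_eq_succ_of_ne_one (ne_bot_of_gt hb : b ≠ 1)
  have hc : max N a < c := by simpa using hb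
  have hNc : N < c := (le_max_left _ _).trans_lt hc
  have hac : a < c := (le_max_right _ _).trans_lt hc
  have h1 := lt_of_length_lt hab (show length u < _ by omega)
  refine not_between_of_length_eq hac (PNat.lt_add_right c 1) hl ⟨?_, ?_⟩
  · rw [hN (c + 1) (hNc.trans (PNat.lt_add_right c 1))] at h1
    refine lt_of_le_of_ne ?_ fun h => hac.ne (u.1.injective h)
    rw [hN c hNc]
    exact PNat.lt_add_one_iff.mp h1
  · rw [hN c hNc, hN _ (hNc.trans (PNat.lt_add_right c 1))]
    exact PNat.lt_add_right c 1

/-- Multiplication by `x_k` in the basis of Schubert polynomials. -/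
def monk (k : ℕ+) : (SInf →₀ ℂ) →ₗ[ℂ] (SInf →₀ ℂ) :=
  Finsupp.linearCombination ℂ fun u =>
    Finsupp.ofSupportFinite (monkCoeff k u) (finite_monkCoeff_ne_zero k u)

theorem monk_single (k : ℕ+) (u v : SInf) : monk k (Finsupp.single u 1) v = monkCoeff k u v := by
  rw [monk, Finsupp.linearCombination_single, one_smul, Finsupp.ofSupportFinite_coe]

open Classical in
/-- The divided difference `∂_i` in the basis of Schubert polynomials. -/
def descend (i : ℕ+) : (SInf →₀ ℂ) →ₗ[ℂ] (SInf →₀ ℂ) :=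
  Finsupp.linearCombination ℂ fun w =>
    if Ascent w i then 0 else Finsupp.single (w * simpleTransposition i) 1

theorem descend_single_of_ascent {w : SInf} {i : ℕ+} (h : Ascent w i) :
    descend i (Finsupp.single w 1) = 0 := by
  simp [descend, h]

theorem descend_single_of_not_ascent {w : SInf} {i : ℕ+} (h : ¬ Ascent w i) :
    descend i (Finsupp.single w 1) = Finsupp.single (w * simpleTransposition i) 1 := by
  simp [descend, h]

open Classical in
theorem descend_apply (i : ℕ+) (m : SInf →₀ ℂ) (y : SInf) :
    descend i m y = if Ascent y i then m (y * simpleTransposition i) else 0 := by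
  induction m using Finsupp.induction_linear with
  | zero => simp
  | add f g hf hg => rw [map_add, Finsupp.add_apply, hf, hg, Finsupp.add_apply]; split_ifs <;> simp
  | single w a =>
    rw [← Finsupp.smul_single_one w a, map_smul, Finsupp.smul_apply,
      Finsupp.smul_apply]
    have h1 : w = y * simpleTransposition i ↔ w * simpleTransposition i = y :=
      ⟨fun h => h ▸ mul_simple_cancel y i, fun h => h ▸ (mul_simple_cancel w i).symm⟩
    have h2 : w * simpleTransposition i = y → (Ascent y i ↔ ¬ Ascent w i) := by
      rintro rfl
      exact ascent_mul_simple
    simp only [Finsupp.single_apply, h1]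
    by_cases h : Ascent w i
    · rw [descend_single_of_ascent h]
      split_ifs with h3 h4
      · exact absurd h ((h2 h4).mp h3)
      all_goals simp
    · rw [descend_single_of_not_ascent h, Finsupp.single_apply]
      split_ifs with h3 h4 h4
      · rfl
      · exact absurd ((h2 h3).mpr h) h4
      all_goals simp

/-- The linear combination of Schubert polynomials with given coefficients. -/
def schubertSum : (SInf →₀ ℂ) →ₗ[ℂ] Poly := Finsupp.linearCombination ℂ schubert

theorem schubertSum_single (w : SInf) : schubertSum (Finsupp.single w 1) = schubert w := by
  simp [schubertSum]

theorem schubertSum_sub_rename (m : SInf →₀ ℂ) (i : ℕ+) :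
    schubertSum m - rename (Equiv.swap i (i + 1)) (schubertSum m) =
      (X i - X (i + 1)) * schubertSum (descend i m) := by
  induction m using Finsupp.induction_linear with
  | zero => simp
  | add f g hf hg =>
    simp only [map_add, mul_add, ← hf, ← hg]
    ring
  | single w a =>
    rw [← Finsupp.smul_single_one w a]
    simp only [map_smul, ← smul_sub, mul_smul_comm, schubertSum_single]
    congr 1
    by_cases h : Ascent w i
    · rw [descend_single_of_ascent h, rename_schubert_of_ascent h, sub_self, map_zero, mul_zero]
    · rw [descend_single_of_not_ascent h, schubert_sub_rename_of_not_ascent h, schubertSum_single]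

theorem nilProd_zero {R A : Type*} [CommRing R] [Ring A] [Algebra R A] (u : ℕ+ → A) (k : ℕ)
    (i : ℕ+) : nilProd u k i (0 : ℕ+ → R) = 1 := by
  have h (k : ℕ) (i : ℕ+) : nilRow u k i (0 : R) = 1 := by
    induction k generalizing i with
    | zero => rfl
    | succ k ih => simp [nilRow, ih, nilFactor]
  induction k generalizing i with
  | zero => rfl
  | succ k ih => rw [nilProd, ih, Pi.zero_apply, h, one_mul]

/-- At `x = 0` the nilCoxeter product is 1, so only the identity permutation has a Schubert
polynomial with nonzero constant term. -/
theorem constantCoeff_schubertSum (m : SInf →₀ ℂ) : constantCoeff (schubertSum m) = m 1 := by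
  induction m using Finsupp.induction_linear with
  | zero => simp
  | add f g hf hg => rw [map_add, map_add, hf, hg, Finsupp.add_apply]
  | single w a =>
    rw [← Finsupp.smul_single_one w a, map_smul, constantCoeff_smul,
      Finsupp.smul_apply, schubertSum_single]
    obtain ⟨N, hN⟩ := exists_fixesAbove w
    have := aeval_schubert hN (Nat.le_succ N) (0 : ℕ+ → ℂ)
    rw [nilProd_zero, Module.End.one_apply, aeval_zero] at this
    congr 1
    classical
    rw [Finsupp.single_apply] at this ⊢
    simp only [eq_comm (a := w)]
    exact this

theorem eq_of_mul_simple_eq {u v : SInf} {i a b : ℕ+} (ha : a = i ∧ b = i + 1)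
    (h : v * simpleTransposition i = u * transposition a b) : v = u := by
  rw [ha.1, ha.2] at h
  exact mul_right_cancel h

/-- Conjugation by `s_i` matches covers by `(a, b)` with covers by `(s_i a, s_i b)`. The order of
the two positions could be reversed only for `(i, i + 1)`, which would force `y = u`. -/
theorem monkCoeff_simple {k i : ℕ+} {u y : SInf} (hu : ¬ Ascent u i) (hy : Ascent y i) :
    monkCoeff (Equiv.swap i (i + 1) k) (u * simpleTransposition i) y =
      monkCoeff k u (y * simpleTransposition i) := by
  have hl1 := length_mul_simple hy
  have hl2 := length_mul_simple' hu
  have hne : y ≠ u := by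
    rintro rfl
    exact hu hy
  by_cases hc : Covers u (y * simpleTransposition i)
  · obtain ⟨a, b, hab, h, hl⟩ := hc
    have hlt := swap_lt_swap hab fun hab => hne (eq_of_mul_simple_eq hab h)
    have hy' : y = u * simpleTransposition i *
        transposition (Equiv.swap i (i + 1) a) (Equiv.swap i (i + 1) b) := by
      rw [← conj_transposition, ← mul_simple_cancel y i, h]
      simp only [← mul_assoc, mul_simple_cancel]
    rw [h, monkCoeff_mul_transposition hab (by rw [← h]; exact hl)]
    conv_lhs => rw [hy']
    rw [monkCoeff_mul_transposition hlt (by rw [← hy']; omega)]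
    simp only [EmbeddingLike.apply_eq_iff_eq]
  · rw [monkCoeff_of_not_covers hc, monkCoeff_of_not_covers]
    rintro ⟨a, b, hab, h, hl⟩
    have h' : y * simpleTransposition i = u *
        transposition (Equiv.swap i (i + 1) a) (Equiv.swap i (i + 1) b) := by
      rw [← conj_transposition, h]
      simp only [← mul_assoc]
    refine hc ⟨_, _, swap_lt_swap hab ?_, h', by omega⟩
    rintro ⟨rfl, rfl⟩
    rw [← simpleTransposition, mul_simple_cancel] at h
    exact hne h

/-- This is the twisted Leibniz rule `∂_i (x_k f) = (s_i x_k) ∂_i f + (∂_i x_k) f`, verified on the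
conjectural Monk coefficients. -/
theorem descend_monk (k i : ℕ+) (u : SInf) :
    descend i (monk k (Finsupp.single u 1)) =
      monk (Equiv.swap i (i + 1) k) (descend i (Finsupp.single u 1)) +
        ((if i = k then 1 else 0) - (if i + 1 = k then 1 else 0) : ℂ) • Finsupp.single u 1 := by
  classical
  have hi : i < i + 1 := PNat.lt_add_right i 1
  ext y
  rw [descend_apply, monk_single, Finsupp.add_apply, Finsupp.smul_apply, smul_eq_mul,
    Finsupp.single_apply]
  by_cases hu : Ascent u i
  · rw [descend_single_of_ascent hu, map_zero, Finsupp.zero_apply, zero_add]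
    by_cases hy : Ascent y i
    · rw [if_pos hy]
      by_cases huy : u = y
      · subst huy
        rw [simpleTransposition, monkCoeff_mul_transposition hi (length_mul_simple hu), if_pos rfl,
          mul_one]
      · rw [if_neg huy, mul_zero, monkCoeff_of_not_covers]
        intro hc
        have := hc.eq_mul_simple hu (fun h => ascent_mul_simple.mp h hy)
        exact huy (mul_right_cancel this).symm
    · rw [if_neg hy, if_neg (c := u = y), mul_zero]
      rintro rfl
      exact hy hu
  · rw [descend_single_of_not_ascent hu, monk_single]
    by_cases hy : Ascent y i
    · rw [if_pos hy, monkCoeff_simple hu hy, if_neg (c := u = y), mul_zero, add_zero]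
      rintro rfl
      exact hu hy
    · rw [if_neg hy]
      by_cases huy : u = y
      · subst huy
        have hu' := ascent_mul_simple.mpr hu
        have h1 : monkCoeff (Equiv.swap i (i + 1) k) (u * simpleTransposition i) u =
            monkCoeff (Equiv.swap i (i + 1) k) (u * simpleTransposition i)
              (u * simpleTransposition i * transposition i (i + 1)) := by
          rw [show u * simpleTransposition i * transposition i (i + 1) = u from
            mul_simple_cancel u i]
        rw [h1, monkCoeff_mul_transposition hi (length_mul_simple hu')]
        have h2 : i = Equiv.swap i (i + 1) k ↔ i + 1 = k := by
          rw [eq_comm, Equiv.swap_apply_eq_iff, Equiv.swap_apply_left, eq_comm]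
        have h3 : i + 1 = Equiv.swap i (i + 1) k ↔ i = k := by
          rw [eq_comm, Equiv.swap_apply_eq_iff, Equiv.swap_apply_right, eq_comm]
        simp only [h2, h3, if_true]
        ring
      · rw [if_neg huy, mul_zero, add_zero, monkCoeff_of_not_covers]
        intro hc
        have := hc.eq_mul_simple (ascent_mul_simple.mpr hu) hy
        rw [mul_simple_cancel] at this
        exact huy this.symm

/-- A symmetric polynomial in infinitely many variables is constant. -/
theorem eq_C_of_rename_swap {f : Poly} (hf : ∀ i : ℕ+, rename (Equiv.swap i (i + 1)) f = f) :
    f = C (constantCoeff f) := by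
  classical
  refine vars_eq_empty_iff_eq_C.mp (Finset.eq_empty_iff_forall_notMem.mpr fun j hj => ?_)
  have hne : f.vars.Nonempty := ⟨j, hj⟩
  have hmax := f.vars.max'_mem hne
  set n := f.vars.max' hne with hn
  have h1 : n ∈ (rename (Equiv.swap n (n + 1)) f).vars := by rwa [hf n]
  obtain ⟨l, hl, hl'⟩ := mem_vars_rename _ _ h1
  rw [Equiv.swap_apply_eq_iff, Equiv.swap_apply_left] at hl'
  have h2 : l ≤ n := f.vars.le_max' l hl
  rw [hl'] at h2
  exact absurd (PNat.lt_add_right n 1) h2.not_gt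

/-- By induction on length, both sides have the same divided differences, so their difference is
symmetric and therefore constant. Its constant term is 0, since no cover ends at the identity. -/
theorem X_mul_schubert (k : ℕ+) (u : SInf) :
    X k * schubert u = schubertSum (monk k (Finsupp.single u 1)) := by
  induction hn : length u using Nat.strong_induction_on generalizing u k with
  | _ n ih =>
    subst hn
    rw [← sub_eq_zero, eq_C_of_rename_swap (f := X k * schubert u - _), map_sub, map_mul,
      constantCoeff_schubertSum, monk_single, monkCoeff_of_not_covers]
    · simp
    · rintro ⟨a, b, -, -, h⟩
      simp [length_one] at h
    · intro i
      have h1 : rename (Equiv.swap i (i + 1)) (schubert u) = schubert u -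
          (X i - X (i + 1)) * schubertSum (descend i (Finsupp.single u 1)) := by
        rw [← schubertSum_sub_rename, schubertSum_single, sub_sub_cancel]
      have h2 : X (Equiv.swap i (i + 1) k) * schubertSum (descend i (Finsupp.single u 1)) =
          schubertSum (monk (Equiv.swap i (i + 1) k) (descend i (Finsupp.single u 1))) := by
        by_cases hu : Ascent u i
        · simp [descend_single_of_ascent hu]
        · have := length_mul_simple' hu
          rw [descend_single_of_not_ascent hu, schubertSum_single]
          exact ih _ (by omega) _ _ rfl
      have h3 := schubertSum_sub_rename (monk k (Finsupp.single u 1)) i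
      rw [descend_monk, map_add, ← h2, map_smul, schubertSum_single] at h3
      have h4 : (X k - X (Equiv.swap i (i + 1) k) : Poly) = (X i - X (i + 1)) *
          C ((if i = k then 1 else 0) - (if i + 1 = k then 1 else 0) : ℂ) := by
        have hi := (PNat.lt_add_right i 1).ne
        by_cases hk : i = k
        · subst hk
          simp [hi.symm]
        · by_cases hk' : i + 1 = k
          · subst hk'
            simp [hi]
          · rw [Equiv.swap_apply_of_ne_of_ne (Ne.symm hk) (Ne.symm hk')]
            simp [hk, hk']
      rw [smul_eq_C_mul] at h3
      rw [map_sub, map_mul, rename_X, h1]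
      linear_combination h3 - h4 * schubert u

theorem X_mul_schubertSum (k : ℕ+) (m : SInf →₀ ℂ) :
    X k * schubertSum m = schubertSum (monk k m) := by
  induction m using Finsupp.induction_linear with
  | zero => simp
  | add f g hf hg => simp only [map_add, mul_add, hf, hg]
  | single w a =>
    rw [← Finsupp.smul_single_one w a]
    simp only [map_smul, mul_smul_comm, schubertSum_single, ← X_mul_schubert]

/-! ### The Schubert polynomials form a basis -/

theorem schubert_one : schubert 1 = 1 := by
  rw [eq_C_of_rename_swap (f := schubert 1), ← schubertSum_single, constantCoeff_schubertSum]
  · simp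
  · intro i
    exact rename_schubert_of_ascent (PNat.lt_add_right i 1)

/-- By Monk's formula the span is closed under multiplication by every variable, and it contains 1.
-/
theorem schubertSum_surjective : Function.Surjective schubertSum := by
  intro f
  induction f using MvPolynomial.induction_on with
  | C a => exact ⟨a • Finsupp.single 1 1, by
      rw [map_smul, schubertSum_single, schubert_one, smul_eq_C_mul, mul_one]⟩
  | add f g hf hg =>
    obtain ⟨m, rfl⟩ := hf
    obtain ⟨n, rfl⟩ := hg
    exact ⟨m + n, map_add _ _ _⟩
  | mul_X f k hf =>
    obtain ⟨m, rfl⟩ := hf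
    exact ⟨monk k m, by rw [← X_mul_schubertSum, mul_comm]⟩

/-- Divided differences along a reduced word move the coefficient at `w` to the identity, where it
is the constant term. -/
theorem schubertSum_injective : Function.Injective schubertSum := by
  rw [← LinearMap.ker_eq_bot, LinearMap.ker_eq_bot']
  intro m hm
  ext w
  rw [Finsupp.zero_apply]
  induction hn : length w generalizing w m with
  | zero => rw [length_eq_zero.mp hn, ← constantCoeff_schubertSum, hm, map_zero]
  | succ n ih =>
    obtain ⟨i, hi⟩ := exists_not_ascent (w := w) (by rintro rfl; simp [length_one] at hn)
    have h1 := schubertSum_sub_rename m i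
    rw [hm, map_zero, sub_zero, eq_comm, mul_eq_zero, sub_eq_zero,
      (X_injective (σ := ℕ+) (R := ℂ)).eq_iff] at h1
    have h2 := h1.resolve_left (PNat.lt_add_right i 1).ne
    have := length_mul_simple' hi
    have h3 := ih _ h2 (w * simpleTransposition i) (by omega)
    rwa [descend_apply, if_pos (ascent_mul_simple.mpr hi), mul_simple_cancel] at h3

/-- The basis of Schubert polynomials. -/
def schubertEquiv : (SInf →₀ ℂ) ≃ₗ[ℂ] Poly :=
  LinearEquiv.ofBijective schubertSum ⟨schubertSum_injective, schubertSum_surjective⟩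

theorem monk_comm (j k : ℕ+) (m : SInf →₀ ℂ) : monk j (monk k m) = monk k (monk j m) := by
  apply schubertSum_injective
  rw [← X_mul_schubertSum, ← X_mul_schubertSum, ← X_mul_schubertSum, ← X_mul_schubertSum,
    mul_left_comm]

/-! ### The pairing -/

theorem iteratedPDeriv_zero (g : Poly) : iteratedPDeriv 0 g = g := by simp [iteratedPDeriv]

theorem iteratedPDeriv_add_single (α : ℕ+ →₀ ℕ) (k : ℕ+) (g : Poly) :
    iteratedPDeriv (α + Finsupp.single k 1) g = iteratedPDeriv α (pderiv k g) := by
  rw [iteratedPDeriv, iteratedPDeriv, map_add, Multiset.foldr_add, Finsupp.toMultiset_single,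
    one_smul, Multiset.foldr_singleton]

theorem multiFactorial_add_single (α : ℕ+ →₀ ℕ) (k : ℕ+) :
    multiFactorial (α + Finsupp.single k 1) = (α k + 1) * multiFactorial α := by
  classical
  have h (β : ℕ+ →₀ ℕ) (hβ : β.support ⊆ insert k α.support) :
      multiFactorial β = Nat.factorial (β k) *
        ∏ i ∈ (insert k α.support).erase k, Nat.factorial (β i) := by
    rw [multiFactorial, Finsupp.prod_of_support_subset β hβ _ (fun _ _ => Nat.factorial_zero),
      ← Finset.mul_prod_erase _ _ (Finset.mem_insert_self k _)]
  rw [h α (Finset.subset_insert _ _), h (α + Finsupp.single k 1), Finsupp.add_apply,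
    Finsupp.single_eq_same, Nat.factorial_succ, mul_assoc]
  · congr 2
    refine Finset.prod_congr rfl fun i hi => ?_
    rw [Finsupp.add_apply, Finsupp.single_eq_of_ne (Finset.ne_of_mem_erase hi), add_zero]
  · refine Finsupp.support_add.trans (Finset.union_subset (Finset.subset_insert _ _) ?_)
    refine Finsupp.support_single_subset.trans ?_
    simp

theorem multiFactorial_ne_zero (α : ℕ+ →₀ ℕ) : (multiFactorial α : ℂ) ≠ 0 :=
  Nat.cast_ne_zero.mpr (Finset.prod_ne_zero_iff.mpr fun _ _ => Nat.factorial_ne_zero _)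

/-- An induction principle that adds one unit at a time. -/
theorem finsupp_induction_add_single {P : (ℕ+ →₀ ℕ) → Prop} (h0 : P 0)
    (h : ∀ α k, P α → P (α + Finsupp.single k 1)) (α : ℕ+ →₀ ℕ) : P α := by
  suffices H : ∀ s : Multiset ℕ+, P (Multiset.toFinsupp s) by
    rw [← Finsupp.toMultiset_toFinsupp α]
    exact H _
  intro s
  induction s using Multiset.induction_on with
  | empty => rwa [map_zero]
  | cons k s ih =>
    rw [← Multiset.singleton_add, map_add, Multiset.toFinsupp_singleton, add_comm]
    exact h _ _ ih

theorem eval_iteratedPDeriv (α : ℕ+ →₀ ℕ) (g : Poly) :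
    eval (fun _ => 0) (iteratedPDeriv α g) = multiFactorial α * coeff α g := by
  induction α using finsupp_induction_add_single generalizing g with
  | h0 =>
    rw [iteratedPDeriv_zero, multiFactorial, Finsupp.prod_zero_index, Nat.cast_one, one_mul]
    exact congrArg (fun φ => φ g) (eval_zero' (R := ℂ) (σ := ℕ+))
  | h α k ih =>
    rw [iteratedPDeriv_add_single, ih, coeff_pderiv, multiFactorial_add_single]
    push_cast
    ring

theorem pairing_eq (f g : Poly) :
    pairing f g = ∑ α ∈ f.support, coeff α f * (multiFactorial α * coeff α g) := by
  simp only [pairing, eval_iteratedPDeriv]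

/-- The pairing as a bilinear map. -/
def pairingHom : Poly →ₗ[ℂ] Poly →ₗ[ℂ] ℂ :=
  (basisMonomials ℕ+ ℂ).constr ℂ fun α => (multiFactorial α : ℂ) • lcoeff ℂ α

theorem pairingHom_monomial (α : ℕ+ →₀ ℕ) (c : ℂ) (g : Poly) :
    pairingHom (monomial α c) g = c * (multiFactorial α * coeff α g) := by
  have h : monomial α c = c • basisMonomials ℕ+ ℂ α := by
    rw [coe_basisMonomials, smul_monomial, smul_eq_mul, mul_one]
  rw [h, map_smul, pairingHom, Module.Basis.constr_basis]
  rfl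

theorem pairing_eq_pairingHom (f g : Poly) : pairing f g = pairingHom f g := by
  conv_rhs => rw [f.as_sum, map_sum, LinearMap.sum_apply]
  rw [pairing_eq]
  exact Finset.sum_congr rfl fun α _ => (pairingHom_monomial _ _ _).symm

theorem pairingHom_one (g : Poly) : pairingHom 1 g = constantCoeff g := by
  rw [← C_1, C_apply, pairingHom_monomial, multiFactorial, Finsupp.prod_zero_index, Nat.cast_one,
    one_mul, one_mul]
  rfl

/-- The adjointness behind everything that follows: derivatives of the second argument become
products in the first. -/
theorem pairingHom_X_mul (k : ℕ+) (f g : Poly) :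
    pairingHom (X k * f) g = pairingHom f (pderiv k g) := by
  induction f using MvPolynomial.induction_on' with
  | monomial α c =>
    rw [X, monomial_mul, one_mul, add_comm, pairingHom_monomial, pairingHom_monomial, coeff_pderiv,
      multiFactorial_add_single]
    push_cast
    ring
  | add f g hf hg => simp only [mul_add, map_add, LinearMap.add_apply, hf, hg]

theorem pairingHom_nondegenerate {g h : Poly} (hgh : ∀ f, pairingHom f g = pairingHom f h) :
    g = h := by
  ext α
  have := hgh (monomial α 1)
  rw [pairingHom_monomial, pairingHom_monomial, one_mul, one_mul] at this
  exact mul_left_cancel₀ (multiFactorial_ne_zero α) this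

/-! ### Partial sums of the variables -/

/-- The partial sum `x_1 + ⋯ + x_k`. -/
def partialSum (k : ℕ+) : Poly := ∑ i ∈ Finset.Icc 1 k, X i

/-- The derivation `∂/∂x_1 + ⋯ + ∂/∂x_k`. -/
def partialDeriv (k : ℕ+) : Derivation ℂ Poly Poly := ∑ i ∈ Finset.Icc 1 k, pderiv i

theorem partialDeriv_apply (k : ℕ+) (g : Poly) :
    partialDeriv k g = ∑ i ∈ Finset.Icc 1 k, pderiv i g := by
  rw [partialDeriv]
  exact congrFun (map_sum (Derivation.coeFnAddMonoidHom (R := ℂ) (A := Poly) (M := Poly)) _ _) g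
    |>.trans (Finset.sum_apply _ _ _)

theorem pairingHom_partialSum_mul (k : ℕ+) (f g : Poly) :
    pairingHom (partialSum k * f) g = pairingHom f (partialDeriv k g) := by
  rw [partialSum, partialDeriv_apply, Finset.sum_mul, map_sum, LinearMap.sum_apply, map_sum]
  exact Finset.sum_congr rfl fun i _ => pairingHom_X_mul i f g

theorem partialDeriv_X (k j : ℕ+) : partialDeriv k (X j) = if j ≤ k then 1 else 0 := by
  rw [partialDeriv_apply]
  simp [pderiv_X, Pi.single_apply]

theorem partialDeriv_diffVar (k j : ℕ+) :
    partialDeriv k (diffVar j) = if j = k then 1 else 0 := by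
  rw [diffVar, map_sub, partialDeriv_X, partialDeriv_X]
  simp only [PNat.add_one_le_iff]
  rcases lt_trichotomy j k with h | rfl | h
  · simp [h, h.le, h.ne]
  · simp
  · simp [h.not_ge, h.not_gt, h.ne']

/-- In the coordinates `X_j` the operator `∂/∂x_1 + ⋯ + ∂/∂x_k` is `∂/∂X_k`. -/
theorem partialDeriv_diffHom (k : ℕ+) (q : Poly) :
    partialDeriv k (diffHom q) = diffHom (pderiv k q) := by
  induction q using MvPolynomial.induction_on with
  | C a =>
    rw [pderiv_C, map_zero, ← algebraMap_eq, AlgHom.commutes, Derivation.map_algebraMap]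
  | add f g hf hg => simp only [map_add, hf, hg]
  | mul_X f j hf =>
    rw [map_mul, Derivation.leibniz, hf, Derivation.leibniz, map_add, smul_eq_mul, smul_eq_mul,
      smul_eq_mul, smul_eq_mul, map_mul, map_mul, pderiv_X, Pi.single_apply]
    rw [show diffHom (X j) = diffVar j from aeval_X _ _, partialDeriv_diffVar]
    congr 2
    split_ifs <;> simp

/-- The substitutions of partial sums and of differences are mutually adjoint inverses:
multiplication by a partial sum is adjoint to `∂/∂X_k`, just as multiplication by a variable is
adjoint to its partial derivative. -/
theorem pairingHom_aeval_diffHom (f q : Poly) :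
    pairingHom (aeval partialSum f) (diffHom q) = pairingHom f q := by
  induction f using MvPolynomial.induction_on generalizing q with
  | C a =>
    rw [← algebraMap_eq, AlgHom.commutes, Algebra.algebraMap_eq_smul_one, map_smul,
      LinearMap.smul_apply, LinearMap.smul_apply, pairingHom_one, pairingHom_one]
    congr 1
    induction q using MvPolynomial.induction_on with
    | C b => rw [← algebraMap_eq, AlgHom.commutes]
    | add f g hf hg => simp only [map_add, hf, hg]
    | mul_X f k _ =>
      rw [map_mul, map_mul, map_mul, diffHom, aeval_X, diffVar, map_sub, constantCoeff_X,
        constantCoeff_X, sub_zero, mul_zero, mul_zero]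
  | add f g hf hg => simp only [map_add, LinearMap.add_apply, hf, hg]
  | mul_X f j hf =>
    rw [map_mul, aeval_X, mul_comm, pairingHom_partialSum_mul, partialDeriv_diffHom, hf, mul_comm,
      pairingHom_X_mul]

theorem aeval_partialSum_surjective :
    Function.Surjective (aeval partialSum : Poly →ₐ[ℂ] Poly) := by
  rw [← AlgHom.range_eq_top, ← top_le_iff, ← adjoin_range_X, Algebra.adjoin_le_iff]
  rintro _ ⟨k, rfl⟩
  induction k using PNat.recOn with
  | one => exact ⟨X 1, by simp [partialSum]⟩
  | succ k _ =>
    refine ⟨X (k + 1) - X k, ?_⟩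
    simp only [AlgHom.toRingHom_eq_coe, RingHom.coe_coe, map_sub, aeval_X]
    have h : Finset.Icc 1 (k + 1) = insert (k + 1) (Finset.Icc 1 k) := by
      ext j
      simp only [Finset.mem_Icc, Finset.mem_insert, one_le, true_and,
        ← PNat.coe_le_coe, ← PNat.coe_inj, PNat.add_coe, PNat.one_coe]
      omega
    rw [partialSum, partialSum, h, Finset.sum_insert, add_sub_cancel_right]
    simp

/-! ### Sums over paths -/

section Paths

variable {β : Type*} (r : SInf → β → Prop) (tgt : β → SInf)

/-- `IsPath r tgt u [b_1, …, b_p] w` says that the steps `b_1, …, b_p` lead from `u` to `w`. -/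
def IsPath : SInf → List β → SInf → Prop
  | u, [], w => u = w
  | u, b :: C, w => r u b ∧ IsPath (tgt b) C w

/-- The set of paths from `u` to `w`. -/
def paths (u w : SInf) : Set (List β) := {C | IsPath r tgt u C w}

variable {r tgt}

theorem IsPath.length_eq (hr : ∀ u b, r u b → Covers u (tgt b)) {u w : SInf} {C : List β}
    (h : IsPath r tgt u C w) : length w = length u + C.length := by
  induction C generalizing u with
  | nil => rw [show u = w from h, List.length_nil, add_zero]
  | cons b C ih =>
    obtain ⟨a, c, -, -, hl⟩ := hr u b h.1
    rw [ih h.2, List.length_cons, hl]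
    ring

theorem IsPath.fixesAbove (hr : ∀ u b, r u b → Covers u (tgt b)) {N : ℕ+} {u w : SInf}
    {C : List β} (h : IsPath r tgt u C w) (hw : FixesAbove N w) : FixesAbove N u := by
  induction C generalizing u with
  | nil => rwa [show u = w from h]
  | cons b C ih => exact (hr u b h.1).fixesAbove (ih h.2)

theorem finite_paths (hr : ∀ u b, r u b → Covers u (tgt b)) {B : Finset β} {w : SInf}
    (hB : ∀ u b C, r u b → IsPath r tgt (tgt b) C w → b ∈ B) (u : SInf) :
    (paths r tgt u w).Finite := by
  refine ((List.finite_length_le B (length w)).image (List.map Subtype.val)).subset fun C hC => ?_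
  have hmem : ∀ b ∈ C, b ∈ B := by
    have hC' : IsPath r tgt u C w := hC
    clear hC
    induction C generalizing u with
    | nil => simp
    | cons b C ih => exact List.forall_mem_cons.mpr ⟨hB u b C hC'.1 hC'.2, ih _ hC'.2⟩
  refine ⟨C.attachWith _ hmem, ?_, by simp⟩
  have := IsPath.length_eq hr hC
  simp only [Set.mem_ofPred_eq, List.length_attachWith]
  omega

open Classical in
-- Decomposition by the first step. The finite set `B` contains every step after which `w` can still
-- be reached.
theorem finsum_paths {M : Type*} [AddCommMonoid M] (hr : ∀ u b, r u b → Covers u (tgt b))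
    {B : Finset β} {w : SInf} (hB : ∀ u b C, r u b → IsPath r tgt (tgt b) C w → b ∈ B)
    (u : SInf) (f : List β → M) :
    ∑ᶠ C ∈ paths r tgt u w, f C = (if u = w then f [] else 0) +
      ∑ b ∈ B, if r u b then ∑ᶠ C ∈ paths r tgt (tgt b) w, f (b :: C) else 0 := by
  have hfin := finite_paths hr hB
  have h1 : paths r tgt u w = (if u = w then {[]} else ∅) ∪
      ⋃ b ∈ (B.filter (r u) : Set β), (List.cons b) '' paths r tgt (tgt b) w := by
    ext C
    rcases C with _ | ⟨b, C⟩
    · by_cases h : u = w <;> simp [paths, IsPath, h]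
    · have : IsPath r tgt u (b :: C) w ↔ r u b ∧ IsPath r tgt (tgt b) C w := Iff.rfl
      have h2 : b :: C ∉ (if u = w then {[]} else ∅ : Set (List β)) := by
        split_ifs <;> simp
      simp only [paths, Set.mem_ofPred_eq, this, Set.mem_union, h2, false_or, Set.mem_iUnion,
        Set.mem_image, Finset.coe_filter, List.cons.injEq, exists_prop]
      constructor
      · exact fun h => ⟨b, ⟨hB u b C h.1 h.2, h.1⟩, C, h.2, rfl, rfl⟩
      · rintro ⟨_, ⟨-, h⟩, _, h', rfl, rfl⟩
        exact ⟨h, h'⟩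
  rw [h1, finsum_mem_union, finsum_mem_biUnion, finsum_mem_coe_finset, Finset.sum_filter]
  · congr 1
    · split_ifs <;> simp
    · refine Finset.sum_congr rfl fun b _ => if_congr Iff.rfl ?_ rfl
      rw [finsum_mem_image (List.cons_injective.injOn)]
  · intro b _ c _ hbc
    rw [Function.onFun, Set.disjoint_left]
    rintro _ ⟨C, -, rfl⟩ ⟨C', -, h⟩
    exact hbc (List.cons.inj h).1.symm
  · exact Finset.finite_toSet _
  · exact fun b _ => (hfin _).image _
  · rw [Set.disjoint_left]
    intro C hC hC'
    simp only [Set.mem_iUnion, Set.mem_image] at hC'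
    obtain ⟨b, -, C, -, rfl⟩ := hC'
    split_ifs at hC <;> simp at hC
  · split_ifs <;> simp
  · exact (Finset.finite_toSet _).biUnion fun b _ => (hfin _).image _

theorem finsum_paths_eq_zero {M : Type*} [AddCommMonoid M]
    (hr : ∀ u b, r u b → Covers u (tgt b)) {u w : SInf} (h : length w < length u)
    (f : List β → M) : ∑ᶠ C ∈ paths r tgt u w, f C = 0 := by
  have : paths r tgt u w = ∅ := by
    ext C
    simp only [Set.mem_empty_iff_false, iff_false]
    intro hC
    have := IsPath.length_eq hr hC
    omega
  rw [this, finsum_mem_empty]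

end Paths

/-! ### Finite sets of permutations -/

theorem finite_fixesAbove (N : ℕ+) : {w : SInf | FixesAbove N w}.Finite := by
  have hle (w : SInf) (hw : FixesAbove N w) (i : ℕ+) (hi : i ≤ N) : w.1 i ≤ N := by
    by_contra h
    rw [not_le] at h
    rw [w.1.injective (hw _ h)] at h
    exact absurd hi h.not_ge
  let F : {w : SInf | FixesAbove N w} → Set.Iic N → Set.Iic N :=
    fun w i => ⟨w.1.1 i, hle w.1 w.2 i i.2⟩
  refine Set.finite_coe_iff.mp ?_
  refine Finite.of_injective F fun v w hvw => Subtype.ext (Subtype.ext (Equiv.ext fun i => ?_))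
  by_cases hi : i ≤ N
  · exact congrArg Subtype.val (congrFun hvw ⟨i, hi⟩)
  · rw [not_le] at hi
    rw [v.2 i hi, w.2 i hi]

/-- The permutations that fix every integer greater than `N`. -/
def permsUpTo (N : ℕ+) : Finset SInf := (finite_fixesAbove N).toFinset

theorem mem_permsUpTo {N : ℕ+} {w : SInf} : w ∈ permsUpTo N ↔ FixesAbove N w := by
  rw [permsUpTo, Set.Finite.mem_toFinset, Set.mem_ofPred_eq]

theorem apply_eq_sum_of_support {φ : (SInf →₀ ℂ) →ₗ[ℂ] ℂ} {P : Finset SInf}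
    (h : ∀ v, v ∉ P → φ (Finsupp.single v 1) = 0) (m : SInf →₀ ℂ) :
    φ m = ∑ v ∈ P, m v * φ (Finsupp.single v 1) := by
  classical
  have h1 : φ m = m.sum fun v a => a * φ (Finsupp.single v 1) := by
    conv_lhs => rw [← m.sum_single, map_finsuppSum]
    refine Finsupp.sum_congr fun v _ => ?_
    rw [← Finsupp.smul_single_one, map_smul, smul_eq_mul]
  rw [h1, Finsupp.sum_of_support_subset m (Finset.subset_union_left (s₂ := P)) _ (by simp)]
  refine (Finset.sum_subset Finset.subset_union_right fun v _ hv => ?_).symm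
  rw [h v hv, mul_zero]

/-- Entries of `M_j M_k = M_k M_j`. The sum may stop at `permsUpTo N`, because everything covered by
`w` lies there. -/
theorem sum_monkCoeff_mul_comm {N : ℕ+} {w : SInf} (hw : w ∈ permsUpTo N) (j k : ℕ+) (u : SInf) :
    ∑ v ∈ permsUpTo N, monkCoeff j u v * monkCoeff k v w =
      ∑ v ∈ permsUpTo N, monkCoeff k u v * monkCoeff j v w := by
  have key (j k : ℕ+) : monk k (monk j (Finsupp.single u 1)) w =
      ∑ v ∈ permsUpTo N, monkCoeff j u v * monkCoeff k v w := by
    have h := apply_eq_sum_of_support (φ := Finsupp.lapply w ∘ₗ monk k) (P := permsUpTo N) ?_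
      (monk j (Finsupp.single u 1))
    · simp only [LinearMap.comp_apply, Finsupp.lapply_apply, monk_single] at h
      exact h
    · intro v hv
      rw [LinearMap.comp_apply, Finsupp.lapply_apply, monk_single]
      refine monkCoeff_of_not_covers fun h => hv ?_
      exact mem_permsUpTo.mpr (h.fixesAbove (mem_permsUpTo.mp hw))
  rw [← key, ← key, monk_comm]

/-! ### Chain polynomials -/

open Classical in
/-- The weight of a Bruhat cover, and `0` for other pairs. -/
def coverWeight (u v : SInf) : Poly := if Covers u v then weight u v else 0

theorem pderiv_coverWeight (k : ℕ+) (u v : SInf) :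
    pderiv k (coverWeight u v) = C (monkCoeff k u v) := by
  by_cases h : Covers u v
  · rw [coverWeight, if_pos h]
    obtain ⟨a, b, hab, rfl, hl⟩ := h
    rw [weight_mul_transposition u hab, monkCoeff_mul_transposition hab hl, map_sub, pderiv_X,
      pderiv_X, Pi.single_apply, Pi.single_apply, map_sub]
    congr 1 <;> split_ifs <;> simp_all
  · rw [coverWeight, if_neg h, monkCoeff_of_not_covers h, map_zero, map_zero]

theorem constantCoeff_coverWeight (u v : SInf) : constantCoeff (coverWeight u v) = 0 := by
  rw [coverWeight]
  split_ifs with h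
  · obtain ⟨a, b, hab, rfl, hl⟩ := h
    rw [weight_mul_transposition u hab, map_sub, constantCoeff_X, constantCoeff_X, sub_zero]
  · exact map_zero _

theorem coverWeight_eq_sum {N : ℕ+} (u : SInf) {v : SInf} (hv : v ∈ permsUpTo N) :
    coverWeight u v = ∑ j ∈ Finset.Icc 1 N, C (monkCoeff j u v) * X j := by
  by_cases h : Covers u v
  · rw [coverWeight, if_pos h]
    rw [mem_permsUpTo] at hv
    obtain ⟨a, b, hab, rfl, hl⟩ := h
    have hb := (hv.of_mul_transposition hab (by omega)).2
    rw [weight_mul_transposition u hab]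
    simp only [monkCoeff_mul_transposition hab hl, map_sub, sub_mul, Finset.sum_sub_distrib,
      apply_ite C, ite_mul, map_one, map_zero, one_mul, zero_mul, Finset.sum_ite_eq,
      Finset.mem_Icc, one_le, true_and, hb, hab.le.trans hb, if_true]
  · rw [coverWeight, if_neg h]
    simp [monkCoeff_of_not_covers h]

theorem covers_id (u v : SInf) (h : Covers u v) : Covers u (id v) := h

theorem chains_eq_paths (u w : SInf) : chains u w = paths Covers id u w := by
  ext C
  change IsChain u C w ↔ IsPath Covers id u C w
  induction C generalizing u with
  | nil => rfl
  | cons v C ih => exact and_congr Iff.rfl (ih v)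

/-- The sum of the weights of all chains from `u` to `w`. -/
def chainSum (u w : SInf) : Poly := ∑ᶠ C ∈ chains u w, chainWeight u C

theorem mem_permsUpTo_of_isPath {N : ℕ+} {w : SInf} (hw : w ∈ permsUpTo N) (u v : SInf)
    (C : List SInf) (_ : Covers u v) (hC : IsPath Covers id v C w) : v ∈ permsUpTo N :=
  mem_permsUpTo.mpr (hC.fixesAbove covers_id (mem_permsUpTo.mp hw))

theorem finite_chains (u w : SInf) : (chains u w).Finite := by
  obtain ⟨N, hN⟩ := exists_fixesAbove w
  rw [chains_eq_paths]
  exact finite_paths covers_id (mem_permsUpTo_of_isPath (mem_permsUpTo.mpr hN)) u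

theorem chainSum_eq_zero_of_notMem {N : ℕ+} {u w : SInf} (hw : w ∈ permsUpTo N)
    (hu : u ∉ permsUpTo N) : chainSum u w = 0 := by
  have : chains u w = ∅ := by
    rw [chains_eq_paths]
    ext C
    simp only [Set.mem_empty_iff_false, iff_false]
    intro hC
    exact hu (mem_permsUpTo.mpr (IsPath.fixesAbove covers_id hC (mem_permsUpTo.mp hw)))
  rw [chainSum, this, finsum_mem_empty]

theorem chainSum_eq_zero_of_length_lt {u w : SInf} (h : length w < length u) :
    chainSum u w = 0 := by
  rw [chainSum, chains_eq_paths, finsum_paths_eq_zero covers_id h]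

open Classical in
theorem chainSum_eq {N : ℕ+} {w : SInf} (hw : w ∈ permsUpTo N) (u : SInf) :
    chainSum u w = (if u = w then 1 else 0) +
      ∑ v ∈ permsUpTo N, coverWeight u v * chainSum v w := by
  simp only [chainSum, chains_eq_paths]
  rw [finsum_paths covers_id (mem_permsUpTo_of_isPath hw)]
  congr 1
  refine Finset.sum_congr rfl fun v _ => ?_
  rw [coverWeight, ite_mul, zero_mul]
  refine if_congr Iff.rfl ?_ rfl
  simp only [id, ← chains_eq_paths]
  exact (mul_finsum_mem (fun C => chainWeight v C) (weight u v)).symm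

theorem constantCoeff_chainSum [DecidableEq SInf] (u w : SInf) :
    constantCoeff (chainSum u w) = if u = w then 1 else 0 := by
  obtain ⟨N, hN⟩ := exists_fixesAbove w
  rw [chainSum_eq (mem_permsUpTo.mpr hN), map_add, map_sum]
  simp only [map_mul, constantCoeff_coverWeight, zero_mul, Finset.sum_const_zero, add_zero]
  split_ifs <;> simp

/-- The matrix `M = ∑ x_j M_j` of cover weights commutes with `M_k`. -/
theorem sum_coverWeight_mul_comm {N : ℕ+} {w : SInf} (hw : w ∈ permsUpTo N) (k : ℕ+) (u : SInf) :
    ∑ v ∈ permsUpTo N, coverWeight u v * C (monkCoeff k v w) =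
      ∑ v ∈ permsUpTo N, C (monkCoeff k u v) * coverWeight v w := by
  have h1 : ∀ v ∈ permsUpTo N, coverWeight u v * C (monkCoeff k v w) =
      ∑ j ∈ Finset.Icc 1 N, C (monkCoeff j u v * monkCoeff k v w) * X j := by
    intro v hv
    rw [coverWeight_eq_sum u hv, Finset.sum_mul]
    refine Finset.sum_congr rfl fun j _ => ?_
    rw [map_mul]
    ring
  have h2 : ∀ v ∈ permsUpTo N, C (monkCoeff k u v) * coverWeight v w =
      ∑ j ∈ Finset.Icc 1 N, C (monkCoeff k u v * monkCoeff j v w) * X j := by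
    intro v _
    rw [coverWeight_eq_sum v hw, Finset.mul_sum]
    refine Finset.sum_congr rfl fun j _ => ?_
    rw [map_mul]
    ring
  rw [Finset.sum_congr rfl h1, Finset.sum_congr rfl h2]
  refine Finset.sum_comm.trans (Eq.trans (Finset.sum_congr rfl fun j _ => ?_) Finset.sum_comm)
  rw [← Finset.sum_mul, ← Finset.sum_mul, ← map_sum, ← map_sum, sum_monkCoeff_mul_comm hw]

/-- Entrywise form of `∂_k M^p = p M_k M^{p-1}`, by induction on `p` from `M^p = M M^{p-1}`, where
commutativity brings `M_k` to the front. If `w` is not longer than `u`, the truncated difference is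
0 and the chain sum is constant. -/
theorem pderiv_chainSum {N : ℕ+} {w : SInf} (hw : w ∈ permsUpTo N) (k : ℕ+) (u : SInf) :
    pderiv k (chainSum u w) = ((length w - length u : ℕ) : Poly) *
      ∑ v ∈ permsUpTo N, C (monkCoeff k u v) * chainSum v w := by
  classical
  have hz (u : SInf) (hu : length w ≤ length u) :
      ∑ v ∈ permsUpTo N, coverWeight u v * chainSum v w = 0 := by
    refine Finset.sum_eq_zero fun v _ => ?_
    rw [coverWeight]
    split_ifs with h
    · obtain ⟨a, b, -, -, hl⟩ := h
      rw [chainSum_eq_zero_of_length_lt (by omega), mul_zero]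
    · rw [zero_mul]
  induction hp : length w - length u generalizing u with
  | zero =>
    rw [chainSum_eq hw, hz u (by omega), Nat.cast_zero, zero_mul, add_zero]
    split_ifs <;> simp
  | succ p ih =>
    have h1 (v : SInf) : pderiv k (coverWeight u v * chainSum v w) =
        C (monkCoeff k u v) * chainSum v w + (p : Poly) * ∑ v' ∈ permsUpTo N,
          coverWeight u v * C (monkCoeff k v v') * chainSum v' w := by
      rw [Derivation.leibniz, pderiv_coverWeight, smul_eq_mul, smul_eq_mul, add_comm,
        mul_comm (chainSum v w)]
      congr 1
      by_cases h : Covers u v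
      · have hl : length w - length v = p := by
          obtain ⟨a, b, -, -, hl⟩ := h
          omega
        rw [ih v hl]
        simp only [Finset.mul_sum]
        refine Finset.sum_congr rfl fun v' _ => ?_
        ring
      · simp [coverWeight, h]
    -- The empty chain at `v = w` must not contribute: a cover `u → w` has `p = 0`, so the factor
    -- `p` kills it.
    have h2 (v : SInf) : (p : Poly) * (C (monkCoeff k u v) * if v = w then 1 else 0) = 0 := by
      by_cases h : Covers u v
      · split_ifs with hv
        · obtain ⟨a, b, -, -, hl⟩ := h
          rw [hv] at hl
          rw [show p = 0 by omega, Nat.cast_zero, zero_mul]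
        · rw [mul_zero, mul_zero]
      · rw [monkCoeff_of_not_covers h, map_zero, zero_mul, mul_zero]
    have h3 : ∑ v ∈ permsUpTo N, (p : Poly) * ∑ v' ∈ permsUpTo N,
          coverWeight u v * C (monkCoeff k v v') * chainSum v' w =
        (p : Poly) * ∑ v ∈ permsUpTo N, C (monkCoeff k u v) * chainSum v w := by
      rw [← Finset.mul_sum, Finset.sum_comm]
      simp only [← Finset.sum_mul]
      rw [Finset.sum_congr rfl fun v' hv' => by rw [sum_coverWeight_mul_comm hv' k u]]
      simp only [Finset.sum_mul]
      rw [Finset.sum_comm, Finset.mul_sum, Finset.mul_sum]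
      refine Finset.sum_congr rfl fun v _ => ?_
      conv_rhs => rw [chainSum_eq hw, mul_add, mul_add, h2, zero_add]
      simp only [Finset.mul_sum, mul_assoc]
    have h4 : pderiv k (if u = w then 1 else 0 : Poly) = 0 := by split_ifs <;> simp
    rw [chainSum_eq hw, map_add, map_sum, h4, zero_add]
    simp only [h1]
    rw [Finset.sum_add_distrib, h3]
    push_cast
    ring

/-! ### Derivatives and pairings of skew dual Schubert polynomials -/

theorem skewDualSchubert_eq (u w : SInf) :
    skewDualSchubert u w = ((Nat.factorial (length w - length u) : ℂ)⁻¹) • chainSum u w := rfl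

/-- Entrywise form of `∂_k exp M = M_k exp M`: the factorial absorbs the factor `p`. -/
theorem pderiv_skewDualSchubert {N : ℕ+} {w : SInf} (hw : w ∈ permsUpTo N) (k : ℕ+) (u : SInf) :
    pderiv k (skewDualSchubert u w) =
      ∑ v ∈ permsUpTo N, monkCoeff k u v • skewDualSchubert v w := by
  rw [skewDualSchubert_eq, Derivation.map_smul, pderiv_chainSum hw, Finset.mul_sum,
    Finset.smul_sum]
  refine Finset.sum_congr rfl fun v _ => ?_
  by_cases h : Covers u v
  · obtain ⟨a, b, -, -, hl⟩ := h
    rw [skewDualSchubert_eq]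
    rcases hp : length w - length u with _ | p
    · rw [chainSum_eq_zero_of_length_lt (by omega)]
      simp
    · rw [show length w - length v = p by omega, C_mul',
        ← map_natCast (C : ℂ →+* Poly), C_mul', smul_smul, smul_smul, smul_smul]
      congr 1
      have h1 : (Nat.factorial p : ℂ) ≠ 0 := Nat.cast_ne_zero.mpr (Nat.factorial_ne_zero p)
      have h2 : ((p + 1 : ℕ) : ℂ) ≠ 0 := Nat.cast_ne_zero.mpr (Nat.succ_ne_zero p)
      rw [Nat.factorial_succ, Nat.cast_mul]
      field_simp
  · simp [monkCoeff_of_not_covers h]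

theorem constantCoeff_skewDualSchubert [DecidableEq SInf] (u w : SInf) :
    constantCoeff (skewDualSchubert u w) = if u = w then 1 else 0 := by
  rw [skewDualSchubert_eq, constantCoeff_smul, constantCoeff_chainSum]
  split_ifs with h
  · simp [h]
  · exact smul_zero _

/-- Pairing with a skew dual Schubert polynomial extracts a coefficient of a product. -/
theorem pairingHom_skewDualSchubert (f : Poly) (u w : SInf) :
    pairingHom f (skewDualSchubert u w) = schubertEquiv.symm (f * schubert u) w := by
  classical
  obtain ⟨N, hN⟩ := exists_fixesAbove w
  have hw := mem_permsUpTo.mpr hN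
  induction f using MvPolynomial.induction_on generalizing u with
  | C a =>
    rw [C_mul', map_smul, ← schubertSum_single,
      show schubertSum (Finsupp.single u 1) = schubertEquiv (Finsupp.single u 1) from rfl,
      LinearEquiv.symm_apply_apply, ← mul_one (C a), C_mul', map_smul, LinearMap.smul_apply,
      pairingHom_one, constantCoeff_skewDualSchubert, Finsupp.smul_apply, Finsupp.single_apply]
  | add f g hf hg => simp only [map_add, add_mul, LinearMap.add_apply, Finsupp.add_apply, hf, hg]
  | mul_X f k hf =>
    rw [mul_assoc, mul_comm f (X k), pairingHom_X_mul, pderiv_skewDualSchubert hw, map_sum,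
      X_mul_schubert]
    simp only [map_smul, smul_eq_mul, hf]
    -- Apply the functional "coefficient of `𝔖_w` in `f · g`" to the Monk expansion of `g = x_k
    -- 𝔖_u`. Terms outside `permsUpTo N` vanish, by the induction hypothesis for `f`, because no
    -- chain leads from there to `w`.
    have h := apply_eq_sum_of_support (φ := Finsupp.lapply w ∘ₗ schubertEquiv.symm.toLinearMap ∘ₗ
      LinearMap.mulLeft ℂ f ∘ₗ schubertSum) (P := permsUpTo N) ?_ (monk k (Finsupp.single u 1))
    · simp only [LinearMap.comp_apply, monk_single, schubertSum_single] at h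
      exact h.symm
    · intro v hv
      simp only [LinearMap.comp_apply, schubertSum_single]
      refine (hf v).symm.trans ?_
      rw [skewDualSchubert_eq, chainSum_eq_zero_of_notMem hw hv, smul_zero, map_zero]

/-! ### The dual Schubert basis -/

theorem lrCoeff_eq (u v w : SInf) :
    lrCoeff u v w = schubertEquiv.symm (schubert u * schubert v) w := by
  have h : ∃ c : SInf →₀ ℂ, schubert u * schubert v = c.sum fun w a => a • schubert w :=
    ⟨schubertEquiv.symm (schubert u * schubert v),
      (schubertEquiv.apply_symm_apply (schubert u * schubert v)).symm⟩
  have h1 : schubert u * schubert v = schubertEquiv (Classical.epsilon _) := Classical.epsilon_spec h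
  rw [h1, LinearEquiv.symm_apply_apply]
  rfl

theorem lrCoeff_eq_pairingHom (u v w : SInf) :
    lrCoeff u v w = pairingHom (schubert v) (skewDualSchubert u w) := by
  rw [lrCoeff_eq, mul_comm, pairingHom_skewDualSchubert]

/-- The coefficient is also the pairing of `𝔖_u` with `𝔇_{v,w}`, which vanishes when no chain leads
from `v` to `w`. -/
theorem lrCoeff_eq_zero {N : ℕ+} {w : SInf} (hw : w ∈ permsUpTo N) (u : SInf) {v : SInf}
    (hv : v ∉ permsUpTo N) : lrCoeff u v w = 0 := by
  rw [lrCoeff_eq, ← pairingHom_skewDualSchubert, skewDualSchubert_eq,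
    chainSum_eq_zero_of_notMem hw hv, smul_zero, map_zero]

theorem finite_lrCoeff_ne_zero (u w : SInf) : {v | lrCoeff u v w ≠ 0}.Finite := by
  obtain ⟨N, hN⟩ := exists_fixesAbove w
  refine (permsUpTo N).finite_toSet.subset fun v hv => ?_
  by_contra h
  exact hv (lrCoeff_eq_zero (mem_permsUpTo.mpr hN) u h)

theorem eq_of_pairingHom_schubert {g h : Poly}
    (hgh : ∀ u, pairingHom (schubert u) g = pairingHom (schubert u) h) : g = h := by
  refine pairingHom_nondegenerate fun f => ?_
  obtain ⟨m, rfl⟩ := schubertSum_surjective f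
  have : pairingHom.flip g ∘ₗ schubertSum = pairingHom.flip h ∘ₗ schubertSum := by
    ext v
    simpa [schubertSum_single] using hgh v
  exact LinearMap.congr_fun this m

open Classical in
theorem pairingHom_skewDualSchubert_one (u w : SInf) :
    pairingHom (schubert u) (skewDualSchubert 1 w) = if u = w then 1 else 0 := by
  rw [pairingHom_skewDualSchubert, schubert_one, mul_one, ← schubertSum_single,
    show schubertSum (Finsupp.single u 1) = schubertEquiv (Finsupp.single u 1) from rfl,
    LinearEquiv.symm_apply_apply, Finsupp.single_apply]

theorem dualSchubert_eq (w : SInf) : dualSchubert w = skewDualSchubert 1 w := by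
  classical
  have h := Classical.epsilon_spec (p := fun f : Poly => ∀ u,
    pairing (schubert u) f = if u = w then 1 else 0) ⟨skewDualSchubert 1 w, fun u => by
      rw [pairing_eq_pairingHom, pairingHom_skewDualSchubert_one]⟩
  refine eq_of_pairingHom_schubert fun u => ?_
  rw [pairingHom_skewDualSchubert_one, ← pairing_eq_pairingHom, dualSchubert]
  convert h u

/-- The expansion of skew dual Schubert polynomials, after any linear map. -/
theorem map_skewDualSchubert_eq_finsum (L : Poly →ₗ[ℂ] Poly) (u w : SInf) :
    L (skewDualSchubert u w) = ∑ᶠ v, lrCoeff u v w • L (dualSchubert v) := by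
  classical
  obtain ⟨N, hN⟩ := exists_fixesAbove w
  have hw := mem_permsUpTo.mpr hN
  rw [finsum_eq_sum_of_support_subset (s := permsUpTo N)]
  · simp only [← map_smul, ← map_sum]
    congr 1
    refine eq_of_pairingHom_schubert fun v => ?_
    rw [map_sum]
    simp only [map_smul, dualSchubert_eq, pairingHom_skewDualSchubert_one, smul_eq_mul, mul_ite,
      mul_one, mul_zero, Finset.sum_ite_eq]
    split_ifs with hv
    · exact (lrCoeff_eq_pairingHom u v w).symm
    · rw [← lrCoeff_eq_pairingHom, lrCoeff_eq_zero hw u hv]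
  · intro v hv
    by_contra h
    refine hv ?_
    change lrCoeff u v w • _ = 0
    rw [lrCoeff_eq_zero hw u h, zero_smul]

/-! ### Labeled chains -/

theorem transposition_injective {a b c d : ℕ+} (hab : a < b) (hcd : c < d)
    (h : transposition a b = transposition c d) : a = c ∧ b = d := by
  have h3 : Equiv.swap a b = Equiv.swap c d := congrArg Subtype.val h
  have ha := congrArg (fun e => e a) h3
  have hb := congrArg (fun e => e b) h3
  simp only [Equiv.swap_apply_left, Equiv.swap_apply_right, Equiv.swap_apply_def] at ha hb
  grind

theorem KCovers.covers {k : ℕ+} {u v : SInf} (h : KCovers k u v) : Covers u v := by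
  obtain ⟨a, b, ha, hb, hv⟩ := h
  exact ⟨a, b, ha.trans_lt hb, hv⟩

theorem KCovers.le {N k : ℕ+} {u v : SInf} (h : KCovers k u v) (hv : v ∈ permsUpTo N) :
    k ≤ N := by
  rw [mem_permsUpTo] at hv
  obtain ⟨a, b, ha, hb, rfl, hl⟩ := h
  exact hb.le.trans (hv.of_mul_transposition (ha.trans_lt hb) (by omega)).2

open Classical in
-- For a cover by `(a, b)` the sum is `[a ≤ k] - [b ≤ k]`, which is 1 exactly when `a ≤ k < b`.
theorem sum_monkCoeff (k : ℕ+) (u v : SInf) :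
    ∑ j ∈ Finset.Icc 1 k, monkCoeff j u v = if KCovers k u v then 1 else 0 := by
  by_cases h : Covers u v
  · obtain ⟨a, b, hab, rfl, hl⟩ := h
    have h1 : KCovers k u (u * transposition a b) ↔ a ≤ k ∧ k < b := by
      constructor
      · rintro ⟨c, d, hc, hd, h, -⟩
        obtain ⟨rfl, rfl⟩ := transposition_injective hab (hc.trans_lt hd) (mul_left_cancel h)
        exact ⟨hc, hd⟩
      · exact fun h => ⟨a, b, h.1, h.2, rfl, hl⟩
    simp only [monkCoeff_mul_transposition hab hl, Finset.sum_sub_distrib, Finset.sum_ite_eq,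
      Finset.mem_Icc, one_le, true_and, h1]
    by_cases ha : a ≤ k
    · by_cases hb : b ≤ k
      · simp [ha, hb, hb.not_gt]
      · simp [ha, hb, not_le.mp hb]
    · have hb : ¬ b ≤ k := fun hb => ha (hab.le.trans hb)
      simp [ha, hb]
  · rw [if_neg fun h' => h h'.covers]
    exact Finset.sum_eq_zero fun j _ => monkCoeff_of_not_covers h

open Classical in
theorem partialDeriv_skewDualSchubert {N : ℕ+} {w : SInf} (hw : w ∈ permsUpTo N) (k : ℕ+)
    (u : SInf) : partialDeriv k (skewDualSchubert u w) =
      ∑ v ∈ permsUpTo N, if KCovers k u v then skewDualSchubert v w else 0 := by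
  rw [partialDeriv_apply]
  simp only [pderiv_skewDualSchubert hw]
  rw [Finset.sum_comm]
  refine Finset.sum_congr rfl fun v _ => ?_
  rw [← Finset.sum_smul, sum_monkCoeff, ite_smul, one_smul, zero_smul]

/-- A labeled step. -/
def labeledStep (u : SInf) (b : ℕ+ × SInf) : Prop := KCovers b.1 u b.2

theorem labeledStep_covers (u : SInf) (b : ℕ+ × SInf) (h : labeledStep u b) : Covers u b.2 :=
  KCovers.covers h

theorem isLabeledChain_iff {u w : SInf} {C : List (ℕ+ × SInf)} :
    IsLabeledChain u C w ↔ C ∈ paths labeledStep Prod.snd u w := by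
  change IsLabeledChain u C w ↔ IsPath labeledStep Prod.snd u C w
  induction C generalizing u with
  | nil => rfl
  | cons v C ih => exact and_congr Iff.rfl ih

theorem mem_of_isPath_labeledStep {N : ℕ+} {w : SInf} (hw : w ∈ permsUpTo N) (u : SInf)
    (b : ℕ+ × SInf) (C : List (ℕ+ × SInf)) (h : labeledStep u b)
    (hC : IsPath labeledStep Prod.snd b.2 C w) : b ∈ Finset.Icc 1 N ×ˢ permsUpTo N := by
  have h1 : b.2 ∈ permsUpTo N :=
    mem_permsUpTo.mpr (hC.fixesAbove labeledStep_covers (mem_permsUpTo.mp hw))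
  exact Finset.mem_product.mpr ⟨Finset.mem_Icc.mpr ⟨one_le, KCovers.le h h1⟩, h1⟩

theorem finite_increasingChains (prec : ℕ+ → ℕ+ → Prop) (u w : SInf) :
    (increasingChains prec u w).Finite := by
  obtain ⟨N, hN⟩ := exists_fixesAbove w
  exact (finite_paths labeledStep_covers (mem_of_isPath_labeledStep (mem_permsUpTo.mpr hN)) u).subset
    fun C hC => isLabeledChain_iff.mp hC.1

open Classical in
/-- Pairing with a product of partial sums counts the labeled chains with given labels. -/
theorem pairingHom_prod_partialSum (d : List ℕ+) (u w : SInf) :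
    pairingHom (d.map partialSum).prod (skewDualSchubert u w) =
      ∑ᶠ C ∈ paths labeledStep Prod.snd u w, if labels C = d then (1 : ℂ) else 0 := by
  obtain ⟨N, hN⟩ := exists_fixesAbove w
  have hw := mem_permsUpTo.mpr hN
  have hsum (u : SInf) (f : List (ℕ+ × SInf) → ℂ) :=
    finsum_paths labeledStep_covers (mem_of_isPath_labeledStep hw) u f
  induction d generalizing u with
  | nil =>
    rw [List.map_nil, List.prod_nil, pairingHom_one, constantCoeff_skewDualSchubert, hsum]
    simp [labels]
  | cons k d ih =>
    rw [List.map_cons, List.prod_cons, pairingHom_partialSum_mul,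
      partialDeriv_skewDualSchubert hw, map_sum, hsum, Finset.sum_product_right]
    have h0 : labels [] ≠ k :: d := by simp [labels]
    rw [if_neg h0, ite_self, zero_add]
    refine Finset.sum_congr rfl fun v hv => ?_
    rw [Finset.sum_eq_single k]
    · simp only [labeledStep, labels, List.map_cons, List.cons.injEq, true_and]
      split_ifs
      · exact ih v
      · exact map_zero _
    · intro j _ hj
      simp [labels, hj]
    · intro hk
      -- A label `k` beyond `N` lies outside the range of summation, but then `v` is not the top of
      -- any `k`-cover.
      rw [if_neg]
      intro h
      exact hk (Finset.mem_Icc.mpr ⟨one_le, KCovers.le h hv⟩)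

/-! ### Contents of words -/

theorem content_cons (k : ℕ+) (d : List ℕ+) : content (k :: d) = content d + Finsupp.single k 1 := by
  rw [content, content, ← Multiset.cons_coe, ← Multiset.singleton_add, map_add,
    Multiset.toFinsupp_singleton, add_comm]

theorem content_nil : content [] = 0 := by simp [content]

theorem degree_content (d : List ℕ+) : (content d).degree = d.length := by
  induction d with
  | nil => rw [content_nil, map_zero, List.length_nil]
  | cons k d ih => rw [content_cons, map_add, ih, Finsupp.degree_single, List.length_cons]

theorem aeval_monomial_content (f : ℕ+ → Poly) (d : List ℕ+) :
    aeval f (monomial (content d) (1 : ℂ)) = (d.map f).prod := by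
  induction d with
  | nil => rw [content_nil, List.map_nil, List.prod_nil]; exact map_one _
  | cons k d ih =>
    rw [content_cons, ← mul_one (1 : ℂ), ← monomial_mul, map_mul, ih,
      show monomial (Finsupp.single k 1) (1 : ℂ) = X k from rfl, aeval_X, mul_comm, List.map_cons,
      List.prod_cons]

theorem diffHom_monomial_content (d : List ℕ+) :
    diffHom (monomial (content d) 1) = wordMonomial d := aeval_monomial_content diffVar d

theorem wordMonomial_eq (d : List ℕ+) : wordMonomial d = diffMonomial (content d) := by
  rw [← diffHom_monomial_content, diffHom_monomial, one_smul]

section Sorting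

variable (prec : ℕ+ → ℕ+ → Prop) [IsStrictTotalOrder ℕ+ prec]

theorem eq_of_content_eq {d e : List ℕ+} (hd : d.Pairwise fun i j => prec i j ∨ i = j)
    (he : e.Pairwise fun i j => prec i j ∨ i = j) (h : content d = content e) : d = e := by
  have : Std.Antisymm fun i j => prec i j ∨ i = j := ⟨fun a b hab hba => by
    rcases hab with hab | rfl
    · rcases hba with hba | rfl
      · exact (asymm hab hba).elim
      · rfl
    · rfl⟩
  exact (Multiset.coe_eq_coe.mp (Multiset.toFinsupp.injective h)).eq_of_pairwise' hd he

theorem exists_content_eq (α : ℕ+ →₀ ℕ) :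
    ∃ d : List ℕ+, d.Pairwise (fun i j => prec i j ∨ i = j) ∧ content d = α := by
  classical
  let r : ℕ+ → ℕ+ → Prop := fun i j => prec i j ∨ i = j
  have h1 : IsTrans ℕ+ r := ⟨fun a b c hab hbc => by
    rcases hab with hab | rfl
    · rcases hbc with hbc | rfl
      · exact Or.inl (_root_.trans hab hbc)
      · exact Or.inl hab
    · exact hbc⟩
  have h2 : Std.Total r := ⟨fun a b => by
    rcases trichotomous_of prec a b with h | h | h
    · exact Or.inl (Or.inl h)
    · exact Or.inl (Or.inr h)
    · exact Or.inr (Or.inl h)⟩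
  refine ⟨(Finsupp.toMultiset α).toList.insertionSort r, List.pairwise_insertionSort r _, ?_⟩
  rw [content, Multiset.coe_eq_coe.mpr (List.perm_insertionSort r _), Multiset.coe_toList,
    Finsupp.toMultiset_toFinsupp]

end Sorting

theorem multiFactorial_mul_coeff_sum {ι : Type*} [DecidableEq (ℕ+ →₀ ℕ)] (s : Finset ι)
    (c : ι → ℕ+ →₀ ℕ) (α : ℕ+ →₀ ℕ) :
    multiFactorial α * coeff α (∑ C ∈ s, (1 / (multiFactorial (c C) : ℂ)) • monomial (c C) 1) =
      ∑ C ∈ s, if c C = α then (1 : ℂ) else 0 := by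
  rw [coeff_sum, Finset.mul_sum]
  refine Finset.sum_congr rfl fun C _ => ?_
  rw [coeff_smul, coeff_monomial]
  split_ifs with h
  · rw [h, smul_eq_mul, mul_one, mul_one_div_cancel (multiFactorial_ne_zero α)]
  · rw [smul_zero, mul_zero]

/-- The expansion of skew dual Schubert polynomials over increasing chains. -/
theorem skewDualSchubert_eq_finsum (prec : ℕ+ → ℕ+ → Prop) [IsStrictTotalOrder ℕ+ prec]
    (u w : SInf) :
    skewDualSchubert u w = ∑ᶠ C ∈ increasingChains prec u w,
      (1 / (multiFactorial (content (labels C)) : ℂ)) • wordMonomial (labels C) := by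
  classical
  have hfin := finite_increasingChains prec u w
  rw [finsum_mem_eq_finite_toFinset_sum _ hfin]
  have h1 : ∑ C ∈ hfin.toFinset, (1 / (multiFactorial (content (labels C)) : ℂ)) •
        wordMonomial (labels C) =
      diffHom (∑ C ∈ hfin.toFinset, (1 / (multiFactorial (content (labels C)) : ℂ)) •
        monomial (content (labels C)) 1) := by
    rw [map_sum]
    refine Finset.sum_congr rfl fun C _ => ?_
    rw [map_smul, diffHom_monomial_content]
  rw [h1]
  refine pairingHom_nondegenerate fun f => ?_
  -- It suffices to test against polynomials in the partial sums, where the pairing with polynomials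
  -- in the differences is the standard one.
  obtain ⟨f, rfl⟩ := aeval_partialSum_surjective f
  rw [pairingHom_aeval_diffHom]
  induction f using MvPolynomial.induction_on' with
  | add f g hf hg => simp only [map_add, LinearMap.add_apply, hf, hg]
  | monomial α a =>
    rw [← mul_one a, ← smul_eq_mul, ← smul_monomial, map_smul, map_smul, map_smul,
      LinearMap.smul_apply, LinearMap.smul_apply]
    congr 1
    -- Since the partial sums commute, their product depends only on the content `α`, so the word
    -- may be taken increasing for `≺`. The labeled chains with label word `d` are then exactly the
    -- increasing chains of content `α`.
    obtain ⟨d, hd, rfl⟩ := exists_content_eq prec α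
    rw [aeval_monomial_content, pairingHom_prod_partialSum, pairingHom_monomial, one_mul,
      multiFactorial_mul_coeff_sum, ← finsum_mem_eq_finite_toFinset_sum _ hfin]
    refine finsum_congr fun C => ?_
    rw [finsum_eq_if, finsum_eq_if, ← ite_and, ← ite_and]
    refine if_congr ?_ rfl rfl
    rw [← isLabeledChain_iff]
    constructor
    · rintro ⟨h, rfl⟩
      exact ⟨⟨h, hd⟩, rfl⟩
    · rintro ⟨⟨h, h'⟩, h2⟩
      exact ⟨h, eq_of_content_eq prec h' hd h2⟩

theorem skewDualSchubert_mem_diffAlgebra (u w : SInf) : skewDualSchubert u w ∈ diffAlgebra := by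
  rw [skewDualSchubert_eq_finsum (· < ·) u w,
    finsum_mem_eq_finite_toFinset_sum _ (finite_increasingChains _ u w)]
  refine sum_mem fun C _ => Subalgebra.smul_mem _ (list_prod_mem fun x hx => ?_) _
  obtain ⟨k, -, rfl⟩ := List.mem_map.mp hx
  exact Algebra.subset_adjoin ⟨k, rfl⟩

theorem length_of_mem_increasingChains {prec : ℕ+ → ℕ+ → Prop} {u w : SInf}
    {C : List (ℕ+ × SInf)} (hC : C ∈ increasingChains prec u w) :
    (content (labels C)).degree = length w - length u := by
  have h : IsPath labeledStep Prod.snd u C w := isLabeledChain_iff.mp hC.1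
  have := h.length_eq labeledStep_covers
  rw [degree_content, labels, List.length_map]
  omega

/-- The expansion over increasing chains, after a scaling. -/
theorem rescale_skewDualSchubert (prec : ℕ+ → ℕ+ → Prop) [IsStrictTotalOrder ℕ+ prec]
    (c : (ℕ+ →₀ ℕ) → ℂ) (u w : SInf) :
    rescale c (skewDualSchubert u w) = ∑ᶠ C ∈ increasingChains prec u w,
      (c (content (labels C)) / (multiFactorial (content (labels C)) : ℂ)) •
        wordMonomial (labels C) := by
  rw [skewDualSchubert_eq_finsum prec u w]
  refine ((rescale c).toAddMonoidHom.map_finsum_mem _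
    (finite_increasingChains prec u w)).trans (finsum_mem_congr rfl fun C _ => ?_)
  change rescale c _ = _
  rw [map_smul, wordMonomial_eq, rescale_diffMonomial, smul_smul, one_div, inv_mul_eq_div]

end

end DualSchubert

/-! ### The corollary -/

open DualSchubert in
theorem corollary3p2 (prec : ℕ+ → ℕ+ → Prop) [IsStrictTotalOrder ℕ+ prec]
    (u w : SInf) (huw : BruhatLE u w) :
    -- the sums are finite, and the dual Schubert polynomials lie in the domain of the scalings
    ((chains u w).Finite ∧ (increasingChains prec u w).Finite ∧ {v | lrCoeff u v w ≠ 0}.Finite ∧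
      skewDualSchubert u w ∈ diffAlgebra ∧ ∀ v, dualSchubert v ∈ diffAlgebra) ∧
    -- the identities without scaling
    (skewDualSchubert u w =
        ∑ᶠ C ∈ increasingChains prec u w,
          (1 / (multiFactorial (content (labels C)) : ℂ)) • wordMonomial (labels C) ∧
      skewDualSchubert u w = ∑ᶠ v, lrCoeff u v w • dualSchubert v) ∧
    -- the identities scaled by `X^α ↦ (p! / α!) X^α`
    (bar (skewDualSchubert u w) =
        ∑ᶠ C ∈ increasingChains prec u w,
          ((Nat.factorial (length w - length u) : ℂ) /
            (multiFactorial (content (labels C)) : ℂ) ^ 2) • wordMonomial (labels C) ∧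
      bar (skewDualSchubert u w) = ∑ᶠ v, lrCoeff u v w • bar (dualSchubert v)) ∧
    -- the identities scaled by `X^α ↦ (α! / p!) X^α`
    (barInv (skewDualSchubert u w) =
        (1 / (Nat.factorial (length w - length u) : ℂ)) •
          ∑ᶠ C ∈ increasingChains prec u w, wordMonomial (labels C) ∧
      barInv (skewDualSchubert u w) = ∑ᶠ v, lrCoeff u v w • barInv (dualSchubert v)) := by
  refine ⟨⟨finite_chains u w, finite_increasingChains prec u w, finite_lrCoeff_ne_zero u w,
    skewDualSchubert_mem_diffAlgebra u w, fun v => ?_⟩,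
    ⟨skewDualSchubert_eq_finsum prec u w, map_skewDualSchubert_eq_finsum LinearMap.id u w⟩,
    ⟨?_, map_skewDualSchubert_eq_finsum bar u w⟩, ⟨?_, map_skewDualSchubert_eq_finsum barInv u w⟩⟩
  · rw [dualSchubert_eq]
    exact skewDualSchubert_mem_diffAlgebra 1 v
  · rw [bar, rescale_skewDualSchubert prec]
    refine finsum_mem_congr rfl fun C hC => ?_
    rw [length_of_mem_increasingChains hC, div_div, sq]
  · rw [barInv, rescale_skewDualSchubert prec,
      smul_finsum_mem (finite_increasingChains prec u w)]
    refine finsum_mem_congr rfl fun C hC => ?_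
    rw [length_of_mem_increasingChains hC, div_right_comm, div_self (multiFactorial_ne_zero _)]
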